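/- Let $\{\psi_{lk}: l\ge J_0-1\}$ be an $S$-regular orthonormal wavelet basis of $L^2([0,1])$: the Haar basis ($S=J_0=0$), a periodised basis ($J_0=0$), or a boundary-corrected (Cohen–Daubechies–Vial) basis with $J_0$ large enough; by convention the scaling functions form the level $l=J_0-1$. Identify $f\in L^2([0,1])$ with $(\langle f,\psi_{lk}\rangle)_{l,k}$. Let $(w_l)_{l\ge J_0-1}$ be increasing with $w_l\ge 1$, let $\|x\|_{\mathcal M(w)}=\sup_l\max_k|x_{lk}|/w_l$, and let $\mathcal M_0(w)$ be the Banach space of all double sequences $x=(x_{lk})$ with $\max_k|x_{lk}|/w_l\to0$ as $l\to\infty$, with this norm. Call $w$ admissible if $w_l/\sqrt l\uparrow\infty$ as $l\to\infty$. For a metric space $E$ let $\beta_E(\mu,\nu)=\sup\{|\int F\,d\mu-\int F\,d\nu| : \sup|F|+\mathrm{Lip}(F)\le1\}$ be the bounded-Lipschitz metric between Borel probability measures on $E$. Fix $f_0$ and consider, for each $n\ge 1$, one of two models. White noise model: $f_0\in L^2([0,1])$ and one observes $X=\mathbb X^{(n)}=f_0+n^{-1/2}\mathbb W$ with $\mathbb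 W$ a standard Gaussian white noise, i.e. the coefficients $\langle f_0,\psi_{lk}\rangle+n^{-1/2}\mathbb W(\psi_{lk})$. Sampling model: $f_0$ is a bounded probability density on $[0,1]$, $dP_0=f_0\,dx$, and one observes $X=(X_1,\dots,X_n)$ i.i.d. from $P_0$. Write $P_{f_0}$ for the law of the data. Let $\Pi$ (possibly depending on $n$) be a prior probability measure on $L^2([0,1])$ (in the sampling model, concentrated on probability densities), and let $\Pi(\cdot\mid X)$ be a version of the corresponding posterior distribution of $f$. Suppose that $\Pi$ satisfies the weak Bernstein–von Mises phenomenon in $\mathcal M_0(w)$ with centring $T_n=T_n(X)$, that is, $w$ is admissible and $$\beta_{\mathcal M_0(w)}\big(\mathcal L(\sqrt n(f-T_n)\mid X),\mathcal N\big)\to^{P_{f_0}}0\qquad(n\to\infty),$$ where $f\sim\Pi(\cdot\mid X)$ and $\mathcal N$ is the law in $\mathcal M_0(w)$ of $(\mathbb W(\psi_{lk}))_{l,k}$ in the white noise model, respectively of the $P_0$-white bridge $(\mathbb G_{P_0}(\psi_{lk}))_{l,k}$ in the sampling model, i.e. the centred Gaussian sequence with covariances $\mathrm{Cov}_{P_0}(\psi_{lk},\psi_{l'k'})$.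 Suppose further that $\sum_l w_l2^{-l/2}<\infty$, and that either $T_n(X)\in L^2([0,1])$, in which case put $\mathbb T_n(t)=\int_0^tT_n(x)\,dx$, or (white noise model only) $T_n=\mathbb X^{(n)}$, in which case put $\mathbb T_n(t)=\int_0^tdX^{(n)}(x)=\int_0^tf_0(x)\,dx+n^{-1/2}\mathbb W(1_{[0,t]})$, taken in its continuous version. For $f\sim\Pi(\cdot\mid X)$ let $F(t)=\int_0^tf(x)\,dx$, $t\in[0,1]$. Let $G$ be a standard Brownian motion on $[0,1]$ in the white noise model, and a $P_0$-Brownian bridge in the sampling model, that is, the continuous centred Gaussian process with covariance $F_0(s\wedge t)-F_0(s)F_0(t)$, $F_0(t)=\int_0^tf_0(x)\,dx$. Then, as $n\to\infty$, $$\beta_{C([0,1])}\big(\mathcal L(\sqrt n(F-\mathbb T_n)\mid X),\mathcal L(G)\big)\to^{P_{f_0}}0,$$ $$\beta_{\mathbb R}\big(\mathcal L(\sqrt n\|F-\mathbb T_n\|_\infty\mid X),\mathcal L(\|G\|_\infty)\big)\to^{P_{f_0}}0.$$ -/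

import Mathlib

open MeasureTheory ProbabilityTheory Filter Set
open scoped Topology NNReal ENNReal

noncomputable section

namespace MultiscaleBvM

/-! ### The spaces `L²([0,1])` and `C([0,1])` -/

/-- Lebesgue measure on `[0,1]`. -/
abbrev leb01 : Measure ℝ := volume.restrict (Icc (0 : ℝ) 1)

/-- The Hilbert space `L²([0,1])`. -/
abbrev L2 : Type := Lp ℝ 2 leb01

instance : MeasurableSpace L2 := borel L2
instance : BorelSpace L2 := ⟨rfl⟩

/-- The space `C([0,1])` with the supremum norm. -/
abbrev C01 : Type := C(unitInterval, ℝ)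

instance : MeasurableSpace C01 := borel C01
instance : BorelSpace C01 := ⟨rfl⟩

theorem L2.integrableOn (f : L2) : IntegrableOn f (Icc (0 : ℝ) 1) := by
  have h : MemLp f 2 leb01 := Lp.memLp f
  exact h.integrable (by norm_num)

theorem L2.continuousOn_primitive (f : L2) :
    ContinuousOn (fun t : ℝ => ∫ x in (0 : ℝ)..t, f x) (Icc 0 1) := by
  have h := intervalIntegral.continuousOn_primitive_interval (a := (0 : ℝ)) (b := 1)
    (f := f) (μ := volume) (by rw [uIcc_of_le zero_le_one]; exact f.integrableOn)
  rwa [uIcc_of_le zero_le_one] at h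

/-- The primitive `t ↦ ∫₀ᵗ f(x) dx` of `f ∈ L²([0,1])`, as an element of `C([0,1])`. -/
def primitive (f : L2) : C01 where
  toFun t := ∫ x in (0 : ℝ)..(t : ℝ), f x
  continuous_toFun := f.continuousOn_primitive.comp_continuous continuous_subtype_val
    (fun t => t.2)

/-- The indicator function `1_{[0,t]}` as an element of `L²([0,1])`. -/
def ind (t : unitInterval) : L2 :=
  indicatorConstLp 2 (s := Icc (0 : ℝ) t) measurableSet_Icc (measure_ne_top _ _) (1 : ℝ)

/-! ### The bounded-Lipschitz metric -/

/-- `‖F‖_BL = sup |F| + Lip(F) ≤ 1`. -/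
def IsBLUnit {E : Type*} [PseudoMetricSpace E] (F : E → ℝ) : Prop :=
  ∃ a b : ℝ≥0, a + b ≤ 1 ∧ (∀ x, |F x| ≤ a) ∧ LipschitzWith b F

/-- The bounded-Lipschitz metric `β_E(μ, ν) = sup_{‖F‖_BL ≤ 1} |∫ F dμ - ∫ F dν|`
(used for probability measures only). -/
def blDist {E : Type*} [PseudoMetricSpace E] [MeasurableSpace E] (μ ν : Measure E) : ℝ :=
  ⨆ F : {F : E → ℝ // IsBLUnit F}, |∫ x, F.1 x ∂μ - ∫ x, F.1 x ∂ν|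

/-! ### Wavelet bases of `L²([0,1])` -/

/-- A family of functions is an orthonormal basis of `L²(μ)`. -/
structure IsONB {ι : Type*} (μ : Measure ℝ) (u : ι → ℝ → ℝ) : Prop where
  memLp : ∀ i, MemLp (u i) 2 μ
  orthonormal : Orthonormal ℝ (fun i => (memLp i).toLp (u i))
  complete : (Submodule.span ℝ (range fun i => (memLp i).toLp (u i))).topologicalClosure = ⊤

/-- The function `x ↦ 2^{l/2} g(2^l x - k)`. -/
def dil (g : ℝ → ℝ) (l : ℕ) (k : ℤ) (x : ℝ) : ℝ :=
  (2 : ℝ) ^ ((l : ℝ) / 2) * g ((2 : ℝ) ^ l * x - k)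

/-- The wavelet system on the line: `φ(x - k)` and `2^{l/2} ψ(2^l x - k)`, `l ≥ 0`, `k ∈ ℤ`. -/
def lineSystem (φ ψ : ℝ → ℝ) : ℤ ⊕ (ℕ × ℤ) → ℝ → ℝ
  | Sum.inl k => dil φ 0 k
  | Sum.inr (l, k) => dil ψ l k

/-- The function `g` is `C^S` and decays rapidly together with its derivatives up to order `S`. -/
def IsRegularFunction (S : ℕ) (g : ℝ → ℝ) : Prop :=
  ContDiff ℝ S g ∧
    ∀ i ≤ S, ∀ m : ℕ, ∃ C : ℝ, ∀ x, |iteratedDeriv i g x| * (1 + |x|) ^ m ≤ C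

/-- `φ` (scaling function) and `ψ` (wavelet) generate an `S`-regular orthonormal wavelet basis
of `L²(ℝ)`. -/
structure IsRegularWaveletPair (S : ℕ) (φ ψ : ℝ → ℝ) : Prop where
  regular_scaling : IsRegularFunction S φ
  regular_wavelet : IsRegularFunction S ψ
  integral_scaling : ∫ x, φ x = 1
  moments : ∀ i ≤ S, ∫ x, x ^ i * ψ x = 0
  onb : IsONB volume (lineSystem φ ψ)

/-- Indices of a wavelet basis of `L²([0,1])` with coarsest level `J₀`. The pair `⟨j, k⟩`
is the pair `(l, k)` with `l = J₀ - 1 + j`: for `j = 0` these are the `2^{J₀}` scaling functions of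
level `J₀`, by convention the wavelets of level `J₀ - 1`; for `j ≥ 1` these are the `2^l` wavelets
of level `l ≥ J₀`. -/
abbrev Idx (J₀ : ℕ) : Type := Σ j : ℕ, Fin (2 ^ (J₀ + (j - 1)))

/-- The Haar wavelet `1_{(0,1/2]} - 1_{(1/2,1]}`. -/
def haar (x : ℝ) : ℝ :=
  (Ioc (0 : ℝ) (1 / 2)).indicator 1 x - (Ioc (1 / 2 : ℝ) 1).indicator 1 x

/-- The Haar basis (`S = J₀ = 0`). -/
def IsHaar (S J₀ : ℕ) (u : Idx J₀ → ℝ → ℝ) : Prop :=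
  S = 0 ∧ J₀ = 0 ∧ ∀ x ∈ Icc (0 : ℝ) 1,
    (∀ k, u ⟨0, k⟩ x = 1) ∧
    ∀ j k, u ⟨j + 1, k⟩ x = dil haar (J₀ + j) (k.1 : ℤ) x

/-- A periodised wavelet basis (`J₀ = 0`): `∑ₘ φ(x + m)` and `∑ₘ 2^{l/2} ψ(2^l (x + m) - k)`. -/
def IsPeriodised (S J₀ : ℕ) (u : Idx J₀ → ℝ → ℝ) : Prop :=
  J₀ = 0 ∧ ∃ φ ψ : ℝ → ℝ, IsRegularWaveletPair S φ ψ ∧ ∀ x ∈ Icc (0 : ℝ) 1,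
    (∀ k, u ⟨0, k⟩ x = ∑' m : ℤ, φ (x + m)) ∧
    ∀ j k, u ⟨j + 1, k⟩ x = ∑' m : ℤ, dil ψ (J₀ + j) (k.1 : ℤ) (x + m)

/-- Level `l` of a boundary-corrected system: `N` dilates of left edge functions, `2^l - 2N`
interior functions, and `N` reflected dilates of right edge functions. -/
def edgeSystem (N : ℕ) (g : ℝ → ℝ) (gL gR : ℕ → ℝ → ℝ) (l k : ℕ) (x : ℝ) : ℝ :=
  if k < N then (2 : ℝ) ^ ((l : ℝ) / 2) * gL k ((2 : ℝ) ^ l * x)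
  else if k + N < 2 ^ l then dil g l (k : ℤ) x
  else (2 : ℝ) ^ ((l : ℝ) / 2) * gR (2 ^ l - 1 - k) ((2 : ℝ) ^ l * (1 - x))

/-- An edge function: `C^S` on `[0, ∞)` and vanishing far out. -/
def IsEdgeFunction (S : ℕ) (g : ℝ → ℝ) : Prop :=
  ContDiffOn ℝ S g (Ici 0) ∧ ∃ R : ℝ, ∀ x, R < x → g x = 0

/-- A boundary-corrected wavelet basis (Cohen-Daubechies-Vial): the interior functions come from
a compactly supported `S`-regular pair with supports in `[-N + 1, N]`, and the coarsest level `J₀`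
is so large that the `N` functions at the left edge and the `N` at the right edge do not
interact. -/
def IsBoundaryCorrected (S J₀ : ℕ) (u : Idx J₀ → ℝ → ℝ) : Prop :=
  ∃ (N : ℕ) (φ ψ : ℝ → ℝ) (φL φR ψL ψR : ℕ → ℝ → ℝ),
    1 ≤ N ∧ 2 * N ≤ 2 ^ J₀ ∧ IsRegularWaveletPair S φ ψ ∧
    (∀ x, x ∉ Icc (-(N : ℝ) + 1) N → φ x = 0 ∧ ψ x = 0) ∧
    (∀ k < N, IsEdgeFunction S (φL k) ∧ IsEdgeFunction S (φR k) ∧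
      IsEdgeFunction S (ψL k) ∧ IsEdgeFunction S (ψR k)) ∧
    (∀ k < N, ∀ i ≤ S, ∫ x in Ici (0 : ℝ), x ^ i * ψL k x = 0 ∧
      ∫ x in Ici (0 : ℝ), x ^ i * ψR k x = 0) ∧
    ∀ x ∈ Icc (0 : ℝ) 1,
      (∀ k, u ⟨0, k⟩ x = edgeSystem N φ φL φR J₀ k.1 x) ∧
      ∀ j k, u ⟨j + 1, k⟩ x = edgeSystem N ψ ψL ψR (J₀ + j) k.1 x

/-- An `S`-regular wavelet basis `{ψ_{lk}}` of `L²([0,1])`: an orthonormal basis of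
`L²([0,1])` of Haar, periodised or boundary-corrected wavelets. -/
structure WaveletBasis (S J₀ : ℕ) where
  fn : Idx J₀ → ℝ → ℝ
  onb : IsONB leb01 fn
  form : IsHaar S J₀ fn ∨ IsPeriodised S J₀ fn ∨ IsBoundaryCorrected S J₀ fn

variable {S J₀ : ℕ}

/-- `ψ_{lk}` as an element of `L²([0,1])`. -/
def WaveletBasis.toL2 (u : WaveletBasis S J₀) (i : Idx J₀) : L2 :=
  (u.onb.memLp i).toLp (u.fn i)

/-- The wavelet coefficients `⟨f, ψ_{lk}⟩ = ∫₀¹ f ψ_{lk}` of `f ∈ L²([0,1])`. -/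
def WaveletBasis.coeff (u : WaveletBasis S J₀) (f : L2) (i : Idx J₀) : ℝ :=
  ∫ x, f x * u.fn i x ∂leb01

theorem WaveletBasis.coeff_eq_inner (u : WaveletBasis S J₀) (f : L2) (i : Idx J₀) :
    u.coeff f i = inner ℝ (u.toL2 i) f := by
  rw [L2.inner_def]
  refine integral_congr_ae ?_
  filter_upwards [(u.onb.memLp i).coeFn_toLp] with x hx
  simp [WaveletBasis.toL2, hx]

/-! ### The multiscale spaces `M₀(w)` -/

/-- A monotone increasing weighting sequence with values in `[1, ∞)`; `w j` is the weight
of level `l = J₀ - 1 + j`. -/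
structure Weights where
  toFun : ℕ → ℝ
  mono : Monotone toFun
  one_le : ∀ j, 1 ≤ toFun j

instance : CoeFun Weights (fun _ => ℕ → ℝ) := ⟨Weights.toFun⟩

/-- The level `l = J₀ - 1 + j`, as a real number. -/
def lev (J₀ j : ℕ) : ℝ := (J₀ : ℝ) - 1 + j

/-- `w` is admissible: `w_l / √l ↑ ∞` as `l → ∞`. -/
def Weights.Admissible (J₀ : ℕ) (w : Weights) : Prop :=
  (∃ j₀, MonotoneOn (fun j => w j / √(lev J₀ j)) (Ici j₀)) ∧
    Tendsto (fun j => w j / √(lev J₀ j)) atTop atTop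

theorem Weights.pos (w : Weights) (j : ℕ) : 0 < w j := lt_of_lt_of_le one_pos (w.one_le j)

/-- The sequences `x = (x_{lk})` with `max_k |x_{lk}| / w_l → 0` as `l → ∞`. -/
def m0 (J₀ : ℕ) (w : Weights) : Submodule ℝ (Idx J₀ → ℝ) where
  carrier := {x | ∀ ε > 0, ∀ᶠ j in atTop, ∀ k, |x ⟨j, k⟩| / w j ≤ ε}
  zero_mem' := by
    intro ε hε
    exact Eventually.of_forall fun j k => by simpa using hε.le
  add_mem' := by
    intro x y hx hy ε hε
    filter_upwards [hx (ε / 2) (half_pos hε), hy (ε / 2) (half_pos hε)] with j h1 h2 k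
    calc |x ⟨j, k⟩ + y ⟨j, k⟩| / w j ≤ (|x ⟨j, k⟩| + |y ⟨j, k⟩|) / w j :=
          div_le_div_of_nonneg_right (abs_add_le _ _) (w.pos j).le
      _ = |x ⟨j, k⟩| / w j + |y ⟨j, k⟩| / w j := add_div _ _ _
      _ ≤ ε := by linarith [h1 k, h2 k]
  smul_mem' := by
    intro c x hx ε hε
    filter_upwards [hx (ε / (|c| + 1)) (by positivity)] with j h k
    have h1 := h k
    rw [le_div_iff₀ (by positivity)] at h1
    have h2 : 0 ≤ |x ⟨j, k⟩| / w j := div_nonneg (abs_nonneg _) (w.pos j).le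
    calc |c • x ⟨j, k⟩| / w j = |x ⟨j, k⟩| / w j * |c| := by
          rw [smul_eq_mul, abs_mul]; ring
      _ ≤ ε := by nlinarith

/-- The multiscale space `M₀(w)`. -/
def M0 (J₀ : ℕ) (w : Weights) : Type := m0 J₀ w

variable {w : Weights}

instance : AddCommGroup (M0 J₀ w) := inferInstanceAs (AddCommGroup (m0 J₀ w))
instance : Module ℝ (M0 J₀ w) := inferInstanceAs (Module ℝ (m0 J₀ w))
instance : CoeFun (M0 J₀ w) (fun _ => Idx J₀ → ℝ) := ⟨fun x => Subtype.val x⟩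

theorem M0.bddAbove (x : M0 J₀ w) : BddAbove (range fun i : Idx J₀ => |x i| / w i.1) := by
  obtain ⟨J, hJ⟩ := eventually_atTop.1 (x.2 1 one_pos)
  have hfin : (⋃ j ∈ Finset.range J,
      range fun k : Fin (2 ^ (J₀ + (j - 1))) => |x ⟨j, k⟩| / w j).Finite :=
    Set.Finite.biUnion (Finset.finite_toSet _) fun j _ => finite_range _
  refine (hfin.bddAbove.union (bddAbove_Iic (a := (1 : ℝ)))).mono ?_
  rintro _ ⟨⟨j, k⟩, rfl⟩
  by_cases h : j < J
  · left
    simp only [mem_iUnion]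
    exact ⟨j, Finset.mem_range.2 h, k, rfl⟩
  · right
    exact hJ j (not_lt.1 h) k

instance : Nonempty (Idx J₀) := ⟨⟨0, ⟨0, by positivity⟩⟩⟩

/-- The norm `‖x‖_{M(w)} = sup_l max_k |x_{lk}| / w_l`. -/
def M0.addGroupNorm (J₀ : ℕ) (w : Weights) : AddGroupNorm (M0 J₀ w) where
  toFun x := ⨆ i : Idx J₀, |x i| / w i.1
  map_zero' := by
    have : ∀ i : Idx J₀, (0 : M0 J₀ w) i = 0 := fun i => rfl
    simp [this]
  add_le' x y := by
    refine ciSup_le fun i => ?_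
    have h1 := le_ciSup x.bddAbove i
    have h2 := le_ciSup y.bddAbove i
    have h3 : |(x + y : M0 J₀ w) i| / w i.1 ≤ |x i| / w i.1 + |y i| / w i.1 := by
      rw [← add_div]
      exact div_le_div_of_nonneg_right (abs_add_le _ _) (w.pos _).le
    exact h3.trans (add_le_add h1 h2)
  neg' x := by
    have : ∀ i : Idx J₀, (-x : M0 J₀ w) i = - x i := fun i => rfl
    simp [this]
  eq_zero_of_map_eq_zero' x hx := by
    refine Subtype.ext (funext fun i => ?_)
    have h1 : |x i| / w i.1 ≤ 0 := (le_ciSup x.bddAbove i).trans hx.le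
    have h2 : |x i| ≤ 0 := by
      have := (div_le_iff₀ (w.pos i.1)).1 h1
      simpa using this
    exact abs_eq_zero.1 (le_antisymm h2 (abs_nonneg _))

instance : NormedAddCommGroup (M0 J₀ w) := (M0.addGroupNorm J₀ w).toNormedAddCommGroup
instance : MeasurableSpace (M0 J₀ w) := borel _
instance : BorelSpace (M0 J₀ w) := ⟨rfl⟩

theorem WaveletBasis.coeff_mem (u : WaveletBasis S J₀) (w : Weights) (f : L2) :
    u.coeff f ∈ m0 J₀ w := by
  intro ε hε
  have hs : Summable fun i => ‖inner ℝ (u.toL2 i) f‖ ^ 2 :=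
    u.onb.orthonormal.inner_products_summable f
  have ht := hs.tendsto_cofinite_zero.eventually (gt_mem_nhds (show (0 : ℝ) < ε ^ 2 by positivity))
  rw [Filter.eventually_cofinite] at ht
  obtain ⟨J, hJ⟩ := (ht.image Sigma.fst).bddAbove
  filter_upwards [eventually_gt_atTop J] with j hj k
  by_contra hcon
  have h1 : ε < |u.coeff f ⟨j, k⟩| := by
    refine lt_of_lt_of_le (not_le.1 hcon) (div_le_self (abs_nonneg _) (w.one_le j))
  refine absurd (hJ ⟨⟨j, k⟩, ?_, rfl⟩) (not_le.2 hj)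
  rw [Set.mem_ofPred_eq, not_lt, ← u.coeff_eq_inner, Real.norm_eq_abs]
  exact pow_le_pow_left₀ hε.le h1.le 2

/-- The coefficient sequence of `f ∈ L²([0,1])` as an element of `M₀(w)`. -/
def WaveletBasis.toM0 (u : WaveletBasis S J₀) (w : Weights) (f : L2) : M0 J₀ w :=
  ⟨u.coeff f, u.coeff_mem w f⟩

open Classical in
/-- A sequence viewed as an element of `M₀(w)` if it belongs to it (and `0` otherwise). -/
def M0.ofSeq (w : Weights) (x : Idx J₀ → ℝ) : M0 J₀ w :=
  if h : x ∈ m0 J₀ w then ⟨x, h⟩ else 0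

/-! ### Gaussian processes -/

/-- A centred Gaussian process with covariance function `c`. -/
structure IsCentredGaussian {T Ω : Type*} [MeasurableSpace Ω] (X : T → Ω → ℝ) (P : Measure Ω)
    (c : T → T → ℝ) : Prop where
  gaussian : IsGaussianProcess X P
  centred : ∀ t, P[X t] = 0
  cov_eq : ∀ s t, cov[X s, X t; P] = c s t

/-- `γ` is the law on `C([0,1])` of a Brownian motion on `[0,1]`. -/
def IsBrownianMotionLaw (γ : Measure C01) : Prop :=
  IsCentredGaussian (fun (t : unitInterval) (g : C01) => g t) γ (fun s t => min (s : ℝ) t)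

/-- `γ` is the law on `C([0,1])` of a `P₀`-Brownian bridge, `dP₀ = f₀ dx`, whose covariance
function is `F₀(s ∧ t) - F₀(s) F₀(t)` with `F₀` the distribution function of `P₀`. -/
def IsBrownianBridgeLaw (f₀ : L2) (γ : Measure C01) : Prop :=
  IsCentredGaussian (fun (t : unitInterval) (g : C01) => g t) γ
    (fun s t => primitive f₀ (min s t) - primitive f₀ s * primitive f₀ t)

/-! ### The two statistical models -/

/-- A standard white noise: the centred Gaussian process indexed by `L²([0,1])` with
`E[W(g) W(h)] = ⟨g, h⟩`. -/
def IsWhiteNoise {Ω : Type*} [MeasurableSpace Ω] (W : L2 → Ω → ℝ) (P : Measure Ω) : Prop :=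
  IsCentredGaussian W P (fun g h => inner ℝ g h)

/-- The law `P_f^n` of the observation `𝕏⁽ⁿ⁾ = f + 𝕎/√n` in the white noise model, in terms of the
wavelet coefficients: independent `N(⟨f, ψ_{lk}⟩, 1/n)` variables. -/
def whiteNoiseLaw (u : WaveletBasis S J₀) (n : ℕ) (f : L2) : Measure (Idx J₀ → ℝ) :=
  Measure.infinitePi fun i => gaussianReal (u.coeff f i) ((n : ℝ≥0)⁻¹)

/-- The coefficients `⟨𝕏⁽ⁿ⁾, ψ_{lk}⟩` of the observation `𝕏⁽ⁿ⁾ = f₀ + 𝕎/√n`. -/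
def whiteNoiseObs {Ω : Type*} (u : WaveletBasis S J₀) (f₀ : L2) (W : L2 → Ω → ℝ) (n : ℕ) (ω : Ω) :
    Idx J₀ → ℝ :=
  fun i => u.coeff f₀ i + (√(n : ℝ))⁻¹ * W (u.toL2 i) ω

/-- `Y n` is the (continuous version of the) observed trajectory
`X⁽ⁿ⁾(t) = ∫₀ᵗ dX⁽ⁿ⁾ = ∫₀ᵗ f₀ dx + 𝕎(1_{[0,t]})/√n`. -/
def IsTrajectory {Ω : Type*} [MeasurableSpace Ω] (f₀ : L2) (W : L2 → Ω → ℝ) (P : Measure Ω)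
    (Y : ℕ → Ω → C01) : Prop :=
  ∀ n t, ∀ᵐ ω ∂P, Y n ω t = primitive f₀ t + (√(n : ℝ))⁻¹ * W (ind t) ω

/-- `f ∈ L²([0,1])` is a probability density on `[0,1]`. -/
def IsDensity (f : L2) : Prop :=
  (∀ᵐ x ∂leb01, 0 ≤ f x) ∧ ∫ x, f x ∂leb01 = 1

/-- The measure `P` on `[0,1]` with `dP(x) = f(x) dx`. -/
def densityLaw (f : L2) : Measure ℝ := leb01.withDensity fun x => ENNReal.ofReal (f x)

/-- The law of `X₁, …, Xₙ` i.i.d. with density `f`. -/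
def samplingLaw (n : ℕ) (f : L2) : Measure (Fin n → ℝ) := Measure.pi fun _ => densityLaw f

/-- `κ(· | x)` is a version of the posterior distribution, i.e. of the conditional distribution of
`f` given `X`, when `f ∼ Π` and `X | f ∼ P_f`. -/
def IsPosterior {𝓧 : Type*} [MeasurableSpace 𝓧] (Pf : L2 → Measure 𝓧) (Prior : Measure L2)
    (κ : Kernel 𝓧 L2) : Prop :=
  ∀ (A : Set 𝓧) (B : Set L2), MeasurableSet A → MeasurableSet B →
    ∫⁻ f in B, Pf f A ∂Prior = ∫⁻ f, ∫⁻ x in A, κ x B ∂(Pf f) ∂Prior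

/-! ### The weak Bernstein-von Mises phenomenon and its consequences -/

/-- The covariance of the coordinates of the white noise `𝕎` in `M₀(w)`. -/
def whiteCov (u : WaveletBasis S J₀) (i j : Idx J₀) : ℝ := inner ℝ (u.toL2 i) (u.toL2 j)

/-- The covariance of the coordinates of the `P₀`-white bridge `𝔾_{P₀}` in `M₀(w)`. -/
def bridgeCov (u : WaveletBasis S J₀) (f₀ : L2) (i j : Idx J₀) : ℝ :=
  cov[u.fn i, u.fn j; densityLaw f₀]

/-- The weak Bernstein-von Mises phenomenon in `M₀(w)` with centring `T`: the law `Π̃ₙ` of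
`√n (f - Tₙ)` given `X` satisfies `β(Π̃ₙ, 𝒩) → 0` in `P`-probability, where `w` is admissible and
`𝒩` is the law in `M₀(w)` of the Gaussian sequence with covariance `c`. Here `post n ω` is the
posterior distribution of `f` given the data of sample size `n`. -/
def WeakBvM {Ω : Type*} [MeasurableSpace Ω] (u : WaveletBasis S J₀) (w : Weights) (P : Measure Ω)
    (post : ℕ → Ω → Measure L2) (T : ℕ → Ω → M0 J₀ w) (c : Idx J₀ → Idx J₀ → ℝ) : Prop :=
  w.Admissible J₀ ∧ ∃ 𝒩 : Measure (M0 J₀ w), IsProbabilityMeasure 𝒩 ∧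
    IsCentredGaussian (fun i (x : M0 J₀ w) => x i) 𝒩 c ∧
    TendstoInMeasure P
      (fun n ω => blDist ((post n ω).map fun f => √(n : ℝ) • (u.toM0 w f - T n ω)) 𝒩)
      atTop (fun _ => 0)

/-- `β_{C([0,1])}(ℒ(√n (F - 𝕋ₙ) | X), γ) → 0` in `P`-probability, where `F` is the primitive
of `f ∼ post n ω`. -/
def FunctionalLimit {Ω : Type*} [MeasurableSpace Ω] (P : Measure Ω) (post : ℕ → Ω → Measure L2)
    (TT : ℕ → Ω → C01) (γ : Measure C01) : Prop :=
  TendstoInMeasure P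
    (fun n ω => blDist ((post n ω).map fun f => √(n : ℝ) • (primitive f - TT n ω)) γ)
    atTop (fun _ => 0)

/-- `β_ℝ(ℒ(√n ‖F - 𝕋ₙ‖_∞ | X), ℒ(‖G‖_∞)) → 0` in `P`-probability, where `G ∼ γ`. -/
def KolmogorovSmirnovLimit {Ω : Type*} [MeasurableSpace Ω] (P : Measure Ω)
    (post : ℕ → Ω → Measure L2) (TT : ℕ → Ω → C01) (γ : Measure C01) : Prop :=
  TendstoInMeasure P
    (fun n ω => blDist ((post n ω).map fun f => √(n : ℝ) * ‖primitive f - TT n ω‖)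
      (γ.map fun g => ‖g‖))
    atTop (fun _ => 0)

end MultiscaleBvM

end

open MultiscaleBvM

namespace MultiscaleBvM

/-! ### Decaying functions on the line -/

/-! Integration is a Lipschitz linear map from `M0 J₀ w` to `C01`, and a weak limit theorem passes
through such a map. For `x = (x_{lk})` put `L x = ∑ₗ ∑ₖ x_{lk} ∫₀ᵗ ψ_{lk}` (`seriesPrimitive`).
Since `|x_{lk}| ≤ w_l ‖x‖`, level `l` is at most `w_l ‖x‖ supₜ ∑ₖ |∫₀ᵗ ψ_{lk}|`, and the last factor
is `O(2^{-l/2})`; summability of `w_l 2^{-l/2}` then makes `L` Lipschitz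
(`exists_lipschitzWith_seriesPrimitive`).

The bound on a level (`hasPrimitiveBound`) comes from scaling. By substitution, `∫₀ᵗ ψ_{lk}` is
`2^{-l/2}` times a difference of two values of the primitive of `ψ` at points shifted by `k`. As `ψ`
decays and has integral zero, its primitive decays like `(1 + y²)⁻¹`, and the sum of this over
integer translates is bounded. Periodisation only regroups these translates, and edge functions are
of a fixed number on every level.

Parseval's identity against `1_{[0,t]}` gives `L f = F` for `f ∈ L²` (`seriesPrimitive_toM0`). The
bounded-Lipschitz distance grows by at most the factor `max 1 K` under a `K`-Lipschitz map
(`blDist_map_le`), so `√n (F - L Tₙ)` is close in law to the image of `𝒩` under `L`.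

Two identifications remain. The image of `𝒩` is the law of `G` (`map_seriesPrimitive_eq`): in both
models one continuous bilinear form `B` on `L²` gives the covariances `B ψ_i ψ_j` and `B 1_{[0,s]}
1_{[0,t]}`, so all linear combinations of values have the same characteristic function, and the
evaluations generate the Borel sets of `C01`. For centring at the observation, `L` of the data is
almost surely the observed trajectory, since the difference at each `t` is Gaussian with variance
zero. The statement on the supremum norm follows because the norm is 1-Lipschitz. -/

theorem summable_int_inv_one_add_sq : Summable fun n : ℤ => (1 + (n : ℝ) ^ 2)⁻¹ := by
  have h : Summable fun n : ℤ => 1 / (n : ℝ) ^ 2 := Real.summable_one_div_int_pow.2 one_lt_two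
  -- At `n = 0` the comparison term `1 / n ^ 2` has the value `0`, so the comparison is made off
  -- that point.
  refine Summable.of_norm_bounded_eventually h ?_
  rw [Filter.eventually_cofinite]
  refine (Set.finite_singleton (0 : ℤ)).subset fun n hn => ?_
  by_contra h0
  have h0' : n ≠ 0 := h0
  refine hn ?_
  have : (0 : ℝ) < (n : ℝ) ^ 2 := by positivity
  rw [Real.norm_of_nonneg (by positivity), one_div]
  exact inv_anti₀ this (by linarith)

/-- The sums `∑ₙ (1 + (y - n)²)⁻¹` are bounded uniformly in `y`. -/
theorem exists_tsum_int_inv_one_add_sq_le :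
    ∃ A : ℝ≥0∞, A ≠ ∞ ∧ ∀ y : ℝ, ∑' n : ℤ, ENNReal.ofReal (1 + (y - n) ^ 2)⁻¹ ≤ A := by
  -- Shifting the index by `⌊y⌋` replaces `y` by its fractional part `r`; the factor 4 covers `1 +
  -- n² ≤ 4 (1 + (r - n)²)` for `0 ≤ r < 1`.
  refine ⟨∑' n : ℤ, ENNReal.ofReal (4 * (1 + (n : ℝ) ^ 2)⁻¹), ?_, fun y => ?_⟩
  · rw [← ENNReal.ofReal_tsum_of_nonneg (fun n => by positivity)
      (summable_int_inv_one_add_sq.mul_left 4)]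
    exact ENNReal.ofReal_ne_top
  · rw [← (Equiv.addRight ⌊y⌋).tsum_eq]
    refine ENNReal.tsum_le_tsum fun n => ENNReal.ofReal_le_ofReal ?_
    have h1 := Int.floor_le y
    have h2 := Int.lt_floor_add_one y
    simp only [Equiv.coe_addRight, Int.cast_add]
    rw [← div_eq_mul_inv, inv_eq_one_div, div_le_div_iff₀ (by positivity) (by positivity)]
    set r := y - ⌊y⌋ with hr
    have e : y - (n + ⌊y⌋) = r - n := by rw [hr]; ring
    rw [e]
    have : r < 1 := by linarith
    have : 0 ≤ r := by linarith
    nlinarith [sq_nonneg (2 * r - n)]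

/-- A function `g` with `|g x| ≤ C (1 + x²)⁻²` is dominated by an integrable function. -/
theorem integrable_of_decay {g : ℝ → ℝ} (hg : AEStronglyMeasurable g) {C : ℝ}
    (hC : ∀ x, |g x| ≤ C * (1 + x ^ 2)⁻¹ ^ 2) : Integrable g := by
  have hC0 : 0 ≤ C := by simpa using (abs_nonneg _).trans (hC 0)
  refine (integrable_inv_one_add_sq.const_mul C).mono' hg (Eventually.of_forall fun x => ?_)
  rw [Real.norm_eq_abs]
  refine (hC x).trans (mul_le_mul_of_nonneg_left ?_ hC0)
  refine pow_le_of_le_one (by positivity) (inv_le_one_of_one_le₀ ?_) two_ne_zero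
  nlinarith [sq_nonneg x]

/-- Of the two factors `(1 + x²)⁻¹`, one is bounded on `s` by its value at `y` and the other is
integrated over the line. -/
theorem setIntegral_abs_le_of_decay {g : ℝ → ℝ} {C : ℝ}
    (hC : ∀ x, |g x| ≤ C * (1 + x ^ 2)⁻¹ ^ 2) (y : ℝ) {s : Set ℝ} (hs : MeasurableSet s)
    (hy : ∀ x ∈ s, y ^ 2 ≤ x ^ 2) :
    |∫ x in s, g x| ≤ C * (∫ x : ℝ, (1 + x ^ 2)⁻¹) * (1 + y ^ 2)⁻¹ := by
  have hC0 : 0 ≤ C := by simpa using (abs_nonneg _).trans (hC 0)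
  calc |∫ x in s, g x| ≤ ∫ x in s, C * (1 + y ^ 2)⁻¹ * (1 + x ^ 2)⁻¹ := by
        refine norm_integral_le_of_norm_le (f := g)
          ((integrable_inv_one_add_sq.const_mul _).integrableOn) ?_
        refine (ae_restrict_iff' hs).2 (Eventually.of_forall fun x hx => ?_)
        rw [Real.norm_eq_abs]
        refine (hC x).trans ?_
        rw [pow_two, mul_assoc]
        have h : (1 + x ^ 2)⁻¹ ≤ (1 + y ^ 2)⁻¹ :=
          inv_anti₀ (by positivity) (by linarith [hy x hx])
        exact mul_le_mul_of_nonneg_left (mul_le_mul_of_nonneg_right h (by positivity)) hC0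
    _ ≤ ∫ x : ℝ, C * (1 + y ^ 2)⁻¹ * (1 + x ^ 2)⁻¹ :=
        setIntegral_le_integral (integrable_inv_one_add_sq.const_mul _)
          (Eventually.of_forall fun x => by positivity)
    _ = _ := by rw [integral_const_mul]; ring

/-- The primitive of a decaying function with vanishing integral decays. -/
theorem abs_integral_Iic_le_of_decay {g : ℝ → ℝ} (hg : AEStronglyMeasurable g) {C : ℝ}
    (hC : ∀ x, |g x| ≤ C * (1 + x ^ 2)⁻¹ ^ 2) (h0 : ∫ x, g x = 0) (y : ℝ) :
    |∫ x in Iic y, g x| ≤ C * (∫ x : ℝ, (1 + x ^ 2)⁻¹) * (1 + y ^ 2)⁻¹ := by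
  rcases le_total y 0 with hy | hy
  · refine setIntegral_abs_le_of_decay hC y measurableSet_Iic fun x hx => ?_
    have : x ≤ y := hx
    nlinarith
  -- For `y ≥ 0` the vanishing total integral exchanges `Iic y` for `Ioi y`, on which `|x| ≥ |y|`.
  · have h := integral_add_compl (measurableSet_Iic (a := y)) (integrable_of_decay hg hC)
    rw [h0, compl_Iic] at h
    rw [eq_neg_of_add_eq_zero_left h, abs_neg]
    refine setIntegral_abs_le_of_decay hC y measurableSet_Ioi fun x hx => ?_
    have : y < x := hx
    nlinarith

theorem two_rpow_half_mul_inv_pow (l : ℕ) :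
    (2 : ℝ) ^ ((l : ℝ) / 2) * ((2 : ℝ) ^ l)⁻¹ = (2 : ℝ) ^ (-(l : ℝ) / 2) := by
  rw [← Real.rpow_natCast, ← Real.rpow_neg zero_le_two, ← Real.rpow_add two_pos]
  congr 1
  ring

theorem integral_dil (g : ℝ → ℝ) (hg : Integrable g) (l : ℕ) (n : ℤ) (a b : ℝ) :
    ∫ x in a..b, dil g l n x = (2 : ℝ) ^ (-(l : ℝ) / 2) *
      ((∫ x in Iic ((2 : ℝ) ^ l * b - n), g x) - ∫ x in Iic ((2 : ℝ) ^ l * a - n), g x) := by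
  have h2 : (2 : ℝ) ^ l ≠ 0 := by positivity
  simp only [dil]
  rw [intervalIntegral.integral_const_mul,
    intervalIntegral.integral_comp_mul_sub (fun x => g x) h2,
    intervalIntegral.integral_Iic_sub_Iic hg.integrableOn hg.integrableOn, smul_eq_mul, ← mul_assoc,
    two_rpow_half_mul_inv_pow]

/-- For a decaying `g` with vanishing integral, `∑ₙ |∫ₐᵇ g_{ln}| ≤ A 2^{-l/2}`. -/
theorem exists_tsum_integral_dil_le {g : ℝ → ℝ} (hg : AEStronglyMeasurable g) {C : ℝ}
    (hC : ∀ x, |g x| ≤ C * (1 + x ^ 2)⁻¹ ^ 2) (h0 : ∫ x, g x = 0) :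
    ∃ A : ℝ≥0, ∀ (l : ℕ) (a b : ℝ), ∑' n : ℤ, ‖∫ x in a..b, dil g l n x‖ₑ ≤
      A * ENNReal.ofReal ((2 : ℝ) ^ (-(l : ℝ) / 2)) := by
  obtain ⟨A, hA, hAs⟩ := exists_tsum_int_inv_one_add_sq_le
  set D := C * ∫ x : ℝ, (1 + x ^ 2)⁻¹
  have hdec := abs_integral_Iic_le_of_decay hg hC h0
  have hD : 0 ≤ D := by simpa [D] using (abs_nonneg _).trans (hdec 0)
  have hI : ∀ y : ℝ, ∑' n : ℤ, ‖∫ x in Iic (y - n), g x‖ₑ ≤ ENNReal.ofReal D * A := fun y => by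
    calc ∑' n : ℤ, ‖∫ x in Iic (y - n), g x‖ₑ
        ≤ ∑' n : ℤ, ENNReal.ofReal D * ENNReal.ofReal (1 + (y - n) ^ 2)⁻¹ := by
          refine ENNReal.tsum_le_tsum fun n => ?_
          rw [← ENNReal.ofReal_mul hD, Real.enorm_eq_ofReal_abs]
          exact ENNReal.ofReal_le_ofReal (hdec _)
      _ ≤ _ := by rw [ENNReal.tsum_mul_left]; gcongr; exact hAs y
  have hB : 2 * (ENNReal.ofReal D * A) ≠ ∞ :=
    ENNReal.mul_ne_top ENNReal.ofNat_ne_top (ENNReal.mul_ne_top ENNReal.ofReal_ne_top hA)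
  refine ⟨(2 * (ENNReal.ofReal D * A)).toNNReal, fun l a b => ?_⟩
  rw [ENNReal.coe_toNNReal hB]
  calc ∑' n : ℤ, ‖∫ x in a..b, dil g l n x‖ₑ
      ≤ ∑' n : ℤ, ENNReal.ofReal ((2 : ℝ) ^ (-(l : ℝ) / 2)) *
        (‖∫ x in Iic ((2 : ℝ) ^ l * b - n), g x‖ₑ
          + ‖∫ x in Iic ((2 : ℝ) ^ l * a - n), g x‖ₑ) := by
        refine ENNReal.tsum_le_tsum fun n => ?_
        rw [integral_dil g (integrable_of_decay hg hC), enorm_mul,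
          Real.enorm_of_nonneg (by positivity)]
        gcongr
        exact enorm_sub_le
    _ ≤ ENNReal.ofReal ((2 : ℝ) ^ (-(l : ℝ) / 2)) *
        (ENNReal.ofReal D * A + ENNReal.ofReal D * A) := by
        rw [ENNReal.tsum_mul_left, ENNReal.tsum_add]
        gcongr
        exacts [hI _, hI _]
    _ = _ := by rw [← two_mul, mul_comm]

/-- For a decaying `g`, `∑ₙ |g_{ln}|` is bounded. -/
theorem exists_tsum_dil_le {g : ℝ → ℝ} {C : ℝ} (hC : ∀ x, |g x| ≤ C * (1 + x ^ 2)⁻¹ ^ 2) (l : ℕ) :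
    ∃ A : ℝ≥0, ∀ x : ℝ, ∑' n : ℤ, ‖dil g l n x‖ₑ ≤ A := by
  obtain ⟨A, hA, hAs⟩ := exists_tsum_int_inv_one_add_sq_le
  have hC0 : 0 ≤ C := by simpa using (abs_nonneg _).trans (hC 0)
  have hB : ENNReal.ofReal ((2 : ℝ) ^ ((l : ℝ) / 2) * C) * A ≠ ∞ :=
    ENNReal.mul_ne_top ENNReal.ofReal_ne_top hA
  refine ⟨(ENNReal.ofReal ((2 : ℝ) ^ ((l : ℝ) / 2) * C) * A).toNNReal, fun x => ?_⟩
  rw [ENNReal.coe_toNNReal hB]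
  calc ∑' n : ℤ, ‖dil g l n x‖ₑ
      ≤ ∑' n : ℤ, ENNReal.ofReal ((2 : ℝ) ^ ((l : ℝ) / 2) * C) *
        ENNReal.ofReal (1 + ((2 : ℝ) ^ l * x - n) ^ 2)⁻¹ := by
        refine ENNReal.tsum_le_tsum fun n => ?_
        rw [← ENNReal.ofReal_mul (by positivity), Real.enorm_eq_ofReal_abs, dil, abs_mul,
          abs_of_nonneg (by positivity : (0 : ℝ) ≤ 2 ^ ((l : ℝ) / 2)), mul_assoc]
        refine ENNReal.ofReal_le_ofReal (mul_le_mul_of_nonneg_left ((hC _).trans ?_) (by positivity))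
        refine mul_le_mul_of_nonneg_left ?_ hC0
        refine pow_le_of_le_one (by positivity) (inv_le_one_of_one_le₀ ?_) two_ne_zero
        nlinarith [sq_nonneg ((2 : ℝ) ^ l * x - n)]
    _ ≤ _ := by rw [ENNReal.tsum_mul_left]; gcongr; exact hAs _

/-! ### Primitives of wavelets -/

/-- The primitives of the wavelets satisfy `∑ₖ |∫₀ᵗ ψ_{lk}| ≤ A 2^{-l/2}`. -/
def HasPrimitiveBound {J₀ : ℕ} (u : Idx J₀ → ℝ → ℝ) : Prop :=
  ∃ A : ℝ≥0, ∀ j, ∀ t ∈ Icc (0 : ℝ) 1, ∑ k, ‖∫ x in (0 : ℝ)..t, u ⟨j + 1, k⟩ x‖ₑ ≤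
    A * ENNReal.ofReal ((2 : ℝ) ^ (-((J₀ + j : ℕ) : ℝ) / 2))

theorem sum_fin_le_tsum {n : ℕ} {α : Type*} (f : α → ℝ≥0∞) (e : Fin n → α)
    (he : Function.Injective e) : ∑ k, f (e k) ≤ ∑' n, f n := by
  rw [← tsum_fintype (L := SummationFilter.unconditional _)]
  exact ENNReal.tsum_comp_le_tsum_of_injective he f

theorem injective_fin_int (n : ℕ) : Function.Injective fun k : Fin n => ((k.1 : ℕ) : ℤ) :=
  fun _ _ h => Fin.ext (Int.ofNat_injective h)

theorem integral_congr_unit {f g : ℝ → ℝ} (h : ∀ x ∈ Icc (0 : ℝ) 1, f x = g x) {t : ℝ}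
    (ht : t ∈ Icc (0 : ℝ) 1) : ∫ x in (0 : ℝ)..t, f x = ∫ x in (0 : ℝ)..t, g x := by
  refine intervalIntegral.integral_congr fun x hx => h x ?_
  rw [uIcc_of_le ht.1] at hx
  exact ⟨hx.1, hx.2.trans ht.2⟩

theorem IsRegularFunction.exists_decay {S : ℕ} {g : ℝ → ℝ} (hg : IsRegularFunction S g) :
    ∃ C : ℝ, ∀ x, |g x| ≤ C * (1 + x ^ 2)⁻¹ ^ 2 := by
  -- Order 4 suffices because `(1 + x²)² ≤ (1 + |x|)⁴`.
  obtain ⟨C, hC⟩ := hg.2 0 (Nat.zero_le _) 4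
  refine ⟨C, fun x => ?_⟩
  have h := hC x
  rw [iteratedDeriv_zero] at h
  rw [inv_pow, ← div_eq_mul_inv, le_div_iff₀ (by positivity)]
  refine le_trans (mul_le_mul_of_nonneg_left ?_ (abs_nonneg _)) h
  have h1 : 1 + x ^ 2 ≤ (1 + |x|) ^ 2 := by
    rw [← sq_abs x]; nlinarith [abs_nonneg x]
  calc (1 + x ^ 2) ^ 2 ≤ ((1 + |x|) ^ 2) ^ 2 := pow_le_pow_left₀ (by positivity) h1 2
    _ = (1 + |x|) ^ 4 := by ring

/-! ### The Haar basis -/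

theorem measurable_haar : Measurable haar :=
  (measurable_one.indicator measurableSet_Ioc).sub (measurable_one.indicator measurableSet_Ioc)

/-- The constant is the maximum of `(1 + x²)²` on the support `(0, 1]`. -/
theorem haar_decay (x : ℝ) : |haar x| ≤ 4 * (1 + x ^ 2)⁻¹ ^ 2 := by
  have h0 : 0 ≤ 4 * (1 + x ^ 2)⁻¹ ^ 2 := by positivity
  by_cases hx : x ∈ Ioc (0 : ℝ) 1
  · have h1 : |haar x| ≤ 1 := by
      unfold haar
      by_cases h : x ≤ 1 / 2
      · rw [indicator_of_mem (mem_Ioc.2 ⟨hx.1, h⟩),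
          indicator_of_notMem fun h' => absurd h'.1 (not_lt.2 h)]
        simp
      · rw [indicator_of_notMem fun h' => h h'.2, indicator_of_mem (mem_Ioc.2 ⟨not_le.1 h, hx.2⟩)]
        simp
    refine h1.trans ?_
    rw [inv_pow, ← div_eq_mul_inv, le_div_iff₀ (by positivity)]
    have : x ^ 2 ≤ 1 := pow_le_one₀ hx.1.le hx.2
    nlinarith [sq_nonneg x]
  · have : haar x = 0 := by
      unfold haar
      rw [indicator_of_notMem fun h' => hx ⟨h'.1, h'.2.trans (by norm_num)⟩,
        indicator_of_notMem fun h' => hx ⟨lt_trans (by norm_num) h'.1, h'.2⟩, sub_zero]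
    rwa [this, abs_zero]

theorem integral_haar : ∫ x, haar x = 0 := by
  have hi : ∀ a b : ℝ, Integrable ((Ioc a b).indicator (1 : ℝ → ℝ)) := fun a b =>
    (integrable_indicator_iff measurableSet_Ioc).2
      (integrableOn_const (C := (1 : ℝ)) (measure_Ioc_lt_top.ne))
  unfold haar
  rw [integral_sub (hi _ _) (hi _ _), integral_indicator_one measurableSet_Ioc,
    integral_indicator_one measurableSet_Ioc]
  norm_num [Measure.real]

theorem IsHaar.hasPrimitiveBound {S J₀ : ℕ} {u : Idx J₀ → ℝ → ℝ} (hu : IsHaar S J₀ u) :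
    HasPrimitiveBound u := by
  obtain ⟨A, hA⟩ := exists_tsum_integral_dil_le measurable_haar.aestronglyMeasurable
    haar_decay integral_haar
  refine ⟨A, fun j t ht => ?_⟩
  simp_rw [integral_congr_unit (fun x hx => (hu.2.2 x hx).2 j _) ht]
  exact (sum_fin_le_tsum (fun n : ℤ => ‖∫ x in (0 : ℝ)..t, dil haar (J₀ + j) n x‖ₑ) _
    (injective_fin_int _)).trans (hA _ _ _)

/-! ### Periodised wavelets -/

theorem dil_add_int (g : ℝ → ℝ) (l : ℕ) (k m : ℤ) (x : ℝ) :
    dil g l k (x + m) = dil g l (k - 2 ^ l * m) x := by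
  unfold dil
  congr 2
  push_cast
  ring

/-- Division with remainder by `2 ^ l`. It makes the double sum over `k` and over the periods `m`
part of a single sum over the translates on the line. -/
theorem injective_sub_two_pow_mul (l : ℕ) :
    Function.Injective fun p : Fin (2 ^ l) × ℤ => ((p.1.1 : ℕ) : ℤ) - 2 ^ l * p.2 := by
  rintro ⟨k, m⟩ ⟨k', m'⟩ h
  have h : ((k.1 : ℕ) : ℤ) - 2 ^ l * m = ((k'.1 : ℕ) : ℤ) - 2 ^ l * m' := h
  have hk : (k.1 : ℤ) < 2 ^ l := by exact_mod_cast k.2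
  have hk' : (k'.1 : ℤ) < 2 ^ l := by exact_mod_cast k'.2
  have hkk : (k.1 : ℤ) = k'.1 := by
    have h1 := congrArg (· % (2 ^ l : ℤ)) h
    simp only [Int.sub_mul_emod_self_left] at h1
    rwa [Int.emod_eq_of_lt (by positivity) hk, Int.emod_eq_of_lt (by positivity) hk'] at h1
  have hm : m = m' := by
    rw [hkk] at h
    exact mul_left_cancel₀ (by positivity : (2 ^ l : ℤ) ≠ 0) (by linarith)
  exact Prod.ext (Fin.ext (by exact_mod_cast hkk)) hm

theorem IsPeriodised.hasPrimitiveBound {S J₀ : ℕ} {u : Idx J₀ → ℝ → ℝ}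
    (hu : IsPeriodised S J₀ u) : HasPrimitiveBound u := by
  obtain ⟨-, φ, ψ, hw, hu⟩ := hu
  obtain ⟨C, hC⟩ := hw.regular_wavelet.exists_decay
  have hc : Continuous ψ := hw.regular_wavelet.1.continuous
  have h0 : ∫ x, ψ x = 0 := by simpa using hw.moments 0 (Nat.zero_le _)
  obtain ⟨A, hA⟩ := exists_tsum_integral_dil_le hc.aestronglyMeasurable hC h0
  refine ⟨A, fun j t ht => ?_⟩
  set l := J₀ + j with hl
  -- `B` depends on the level, which is harmless: it serves only to exchange the sum over periods
  -- with the integral.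
  obtain ⟨B, hB⟩ := exists_tsum_dil_le hC l
  have hcd : ∀ n : ℤ, Continuous fun x => dil ψ l n x := fun n => by unfold dil; fun_prop
  have key : ∀ k : Fin (2 ^ l), ∫ x in (0 : ℝ)..t, u ⟨j + 1, k⟩ x =
      ∑' m : ℤ, ∫ x in (0 : ℝ)..t, dil ψ l ((k.1 : ℤ) - 2 ^ l * m) x := fun k => by
    rw [integral_congr_unit (fun x hx => (hu x hx).2 j k) ht]
    simp_rw [← hl, dil_add_int, intervalIntegral.integral_of_le ht.1]
    refine integral_tsum (fun m => (hcd _).aestronglyMeasurable) ?_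
    rw [← lintegral_tsum fun m => (hcd _).measurable.enorm.aemeasurable]
    refine ne_top_of_le_ne_top (b := ∫⁻ _ in Ioc 0 t, (B : ℝ≥0∞)) ?_
      (lintegral_mono fun x => (ENNReal.tsum_comp_le_tsum_of_injective
        (f := fun m : ℤ => (k.1 : ℤ) - 2 ^ l * m) ?_ fun n => ‖dil ψ l n x‖ₑ).trans (hB x))
    · rw [lintegral_const, Measure.restrict_apply_univ]
      exact ENNReal.mul_ne_top ENNReal.coe_ne_top measure_Ioc_lt_top.ne
    · exact (injective_sub_two_pow_mul l).comp (Prod.mk_right_injective k)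
  calc ∑ k : Fin (2 ^ l), ‖∫ x in (0 : ℝ)..t, u ⟨j + 1, k⟩ x‖ₑ
      ≤ ∑ k : Fin (2 ^ l), ∑' m : ℤ,
          ‖∫ x in (0 : ℝ)..t, dil ψ l ((k.1 : ℤ) - 2 ^ l * m) x‖ₑ := by
        refine Finset.sum_le_sum fun k _ => ?_
        rw [key]
        exact enorm_tsum_le_tsum_enorm
    _ = ∑' p : Fin (2 ^ l) × ℤ,
          ‖∫ x in (0 : ℝ)..t, dil ψ l ((p.1.1 : ℤ) - 2 ^ l * p.2) x‖ₑ := by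
        rw [ENNReal.tsum_prod (f := fun (k : Fin (2 ^ l)) (m : ℤ) =>
          ‖∫ x in (0 : ℝ)..t, dil ψ l ((k.1 : ℤ) - 2 ^ l * m) x‖ₑ), tsum_fintype]
    _ ≤ ∑' n : ℤ, ‖∫ x in (0 : ℝ)..t, dil ψ l n x‖ₑ :=
        ENNReal.tsum_comp_le_tsum_of_injective (injective_sub_two_pow_mul l)
          fun n => ‖∫ x in (0 : ℝ)..t, dil ψ l n x‖ₑ
    _ ≤ _ := hA _ _ _

/-! ### Boundary-corrected wavelets -/

theorem IsEdgeFunction.lintegral_ne_top {S : ℕ} {g : ℝ → ℝ} (hg : IsEdgeFunction S g) :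
    ∫⁻ x in Ici 0, ‖g x‖ₑ ≠ ∞ := by
  obtain ⟨hc, R, hR⟩ := hg
  have h1 : IntegrableOn g (Icc 0 R) :=
    (hc.continuousOn.mono Icc_subset_Ici_self).integrableOn_Icc
  have h2 : IntegrableOn g (Ioi R) :=
    (integrableOn_zero (ε' := ℝ)).congr_fun (fun x hx => (hR x hx).symm) measurableSet_Ioi
  refine ((h1.union h2).mono_set fun x hx => ?_).2.ne
  rcases le_or_gt x R with h | h
  exacts [Or.inl ⟨hx, h⟩, Or.inr h]

theorem enorm_intervalIntegral_le {g : ℝ → ℝ} {a b : ℝ} (ha : 0 ≤ a) (hab : a ≤ b) :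
    ‖∫ x in a..b, g x‖ₑ ≤ ∫⁻ x in Ici 0, ‖g x‖ₑ := by
  rw [intervalIntegral.integral_of_le hab]
  exact (enorm_integral_le_lintegral_enorm _).trans
    (lintegral_mono_set fun x hx => ha.trans hx.1.le)

/-- No cancellation is needed at the edges: a level has only `N` functions at each end, so the `L¹`
norm together with the scaling factor is enough. -/
theorem enorm_integral_left_edge_le (g : ℝ → ℝ) (l : ℕ) {t : ℝ} (ht : t ∈ Icc (0 : ℝ) 1) :
    ‖∫ x in (0 : ℝ)..t, (2 : ℝ) ^ ((l : ℝ) / 2) * g ((2 : ℝ) ^ l * x)‖ₑ ≤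
      (∫⁻ x in Ici 0, ‖g x‖ₑ) * ENNReal.ofReal ((2 : ℝ) ^ (-(l : ℝ) / 2)) := by
  have h2 : (2 : ℝ) ^ l ≠ 0 := by positivity
  rw [intervalIntegral.integral_const_mul, intervalIntegral.integral_comp_mul_left _ h2,
    smul_eq_mul, ← mul_assoc, two_rpow_half_mul_inv_pow, enorm_mul,
    Real.enorm_of_nonneg (by positivity), mul_comm]
  gcongr
  exact enorm_intervalIntegral_le (by simp) (by have := ht.1; gcongr)

theorem enorm_integral_right_edge_le (g : ℝ → ℝ) (l : ℕ) {t : ℝ} (ht : t ∈ Icc (0 : ℝ) 1) :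
    ‖∫ x in (0 : ℝ)..t, (2 : ℝ) ^ ((l : ℝ) / 2) * g ((2 : ℝ) ^ l * (1 - x))‖ₑ ≤
      (∫⁻ x in Ici 0, ‖g x‖ₑ) * ENNReal.ofReal ((2 : ℝ) ^ (-(l : ℝ) / 2)) := by
  have h2 : (2 : ℝ) ^ l ≠ 0 := by positivity
  have h3 : (0 : ℝ) < 2 ^ l := by positivity
  simp_rw [mul_one_sub]
  rw [intervalIntegral.integral_const_mul, intervalIntegral.integral_comp_sub_mul _ h2,
    smul_eq_mul, ← mul_assoc, two_rpow_half_mul_inv_pow, enorm_mul,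
    Real.enorm_of_nonneg (by positivity), mul_comm]
  gcongr
  exact enorm_intervalIntegral_le (by nlinarith [ht.2]) (by nlinarith [ht.1])

theorem IsBoundaryCorrected.hasPrimitiveBound {S J₀ : ℕ} {u : Idx J₀ → ℝ → ℝ}
    (hu : IsBoundaryCorrected S J₀ u) : HasPrimitiveBound u := by
  obtain ⟨N, φ, ψ, φL, φR, ψL, ψR, hN, -, hw, -, hE, -, hu⟩ := hu
  obtain ⟨C, hC⟩ := hw.regular_wavelet.exists_decay
  have hc : Continuous ψ := hw.regular_wavelet.1.continuous
  have h0 : ∫ x, ψ x = 0 := by simpa using hw.moments 0 (Nat.zero_le _)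
  obtain ⟨A, hA⟩ := exists_tsum_integral_dil_le hc.aestronglyMeasurable hC h0
  -- Only the first `N` edge functions are controlled; cutting off there gives a finite sum over all
  -- `i`, independent of the level.
  let m : (ℕ → ℝ → ℝ) → ℕ → ℝ≥0∞ := fun g i => if i < N then ∫⁻ x in Ici 0, ‖g i x‖ₑ else 0
  have hm : ∀ g : ℕ → ℝ → ℝ, (∀ i < N, IsEdgeFunction S (g i)) → ∑' i, m g i ≠ ∞ := by
    intro g hg
    rw [tsum_eq_sum (s := Finset.range N) fun i hi => if_neg (by simpa using hi)]
    refine ENNReal.sum_ne_top.2 fun i hi => ?_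
    rw [Finset.mem_range] at hi
    simp only [if_pos hi]
    exact (hg i hi).lintegral_ne_top
  have hL := hm ψL fun i hi => (hE i hi).2.2.1
  have hR := hm ψR fun i hi => (hE i hi).2.2.2
  refine ⟨(∑' i, m ψL i).toNNReal + A + (∑' i, m ψR i).toNNReal, fun j t ht => ?_⟩
  simp only [ENNReal.coe_add, ENNReal.coe_toNNReal hL, ENNReal.coe_toNNReal hR, add_mul]
  simp_rw [integral_congr_unit (fun x hx => (hu x hx).2 j _) ht]
  set l := J₀ + j with hl
  set r := ENNReal.ofReal ((2 : ℝ) ^ (-(l : ℝ) / 2))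
  -- Each of the three kinds of function is bounded by the sum of all three bounds, so that the sum
  -- over `k` splits without case distinctions.
  have hk : ∀ k : Fin (2 ^ l), ‖∫ x in (0 : ℝ)..t, edgeSystem N ψ ψL ψR l k.1 x‖ₑ ≤
      m ψL k.1 * r + ‖∫ x in (0 : ℝ)..t, dil ψ l (k.1 : ℤ) x‖ₑ + m ψR (2 ^ l - 1 - k.1) * r := by
    intro k
    unfold edgeSystem
    split_ifs with h1 h2
    · refine (enorm_integral_left_edge_le (ψL k.1) l ht).trans ?_
      simp only [m, if_pos h1]
      rw [add_assoc]
      exact le_self_add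
    · exact le_add_right le_add_self
    · refine (enorm_integral_right_edge_le (ψR (2 ^ l - 1 - k.1)) l ht).trans ?_
      have h3 : 2 ^ l - 1 - k.1 < N := by omega
      simp only [m, if_pos h3]
      exact le_add_self
  refine (Finset.sum_le_sum fun k _ => hk k).trans ?_
  rw [Finset.sum_add_distrib, Finset.sum_add_distrib, ← Finset.sum_mul, ← Finset.sum_mul]
  refine add_le_add (add_le_add ?_ ?_) ?_
  · exact mul_le_mul_left (sum_fin_le_tsum (m ψL) (fun k : Fin (2 ^ l) => k.1) Fin.val_injective) _
  · exact (sum_fin_le_tsum (fun n : ℤ => ‖∫ x in (0 : ℝ)..t, dil ψ l n x‖ₑ) _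
      (injective_fin_int _)).trans (hA _ _ _)
  · refine mul_le_mul_left (sum_fin_le_tsum (m ψR) (fun k : Fin (2 ^ l) => 2 ^ l - 1 - k.1)
      fun a b h => Fin.ext ?_) _
    have := a.2
    have := b.2
    simp only at h
    omega

theorem WaveletBasis.hasPrimitiveBound {S J₀ : ℕ} (u : WaveletBasis S J₀) :
    HasPrimitiveBound u.fn :=
  u.form.elim IsHaar.hasPrimitiveBound
    (Or.rec IsPeriodised.hasPrimitiveBound IsBoundaryCorrected.hasPrimitiveBound)

/-! ### Primitives as inner products -/

/-- Puts integration up to `t` in Hilbert space form, so that Parseval's identity and the covariance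
forms on `L2` apply to it. -/
theorem primitive_apply_eq_inner (f : L2) (t : unitInterval) :
    primitive f t = inner ℝ (ind t) f := by
  have h : (Icc (0 : ℝ) 1) ∩ Ioc 0 (t : ℝ) = Ioc 0 (t : ℝ) :=
    inter_eq_right.2 fun x hx => ⟨hx.1.le, hx.2.trans t.2.2⟩
  have h' : (Icc (0 : ℝ) t) ∩ Icc 0 1 = Icc 0 (t : ℝ) :=
    inter_eq_left.2 fun x hx => ⟨hx.1, hx.2.trans t.2.2⟩
  rw [ind, L2.inner_indicatorConstLp_one, Measure.restrict_restrict measurableSet_Icc, h',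
    integral_Icc_eq_integral_Ioc, ← intervalIntegral.integral_of_le t.2.1]
  rfl

theorem norm_ind_le (t : unitInterval) : ‖ind t‖ ≤ 1 := by
  have h : leb01 (Icc (0 : ℝ) t) ≤ 1 := by
    rw [Measure.restrict_apply measurableSet_Icc]
    refine (measure_mono inter_subset_right).trans ?_
    simp
  rw [ind, norm_indicatorConstLp two_ne_zero ENNReal.ofNat_ne_top, norm_one, one_mul]
  refine Real.rpow_le_one measureReal_nonneg ?_ (by norm_num)
  exact ENNReal.toReal_le_of_le_ofReal zero_le_one (by simpa using h)

theorem norm_primitive_le (f : L2) : ‖primitive f‖ ≤ ‖f‖ := by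
  refine (ContinuousMap.norm_le _ (norm_nonneg _)).2 fun t => ?_
  rw [primitive_apply_eq_inner]
  refine (norm_inner_le_norm _ _).trans ?_
  exact mul_le_of_le_one_left (norm_nonneg _) (norm_ind_le t)

theorem primitive_sub (f g : L2) : primitive (f - g) = primitive f - primitive g := by
  ext t
  simp [primitive_apply_eq_inner, inner_sub_right]

theorem continuous_primitive : Continuous primitive := by
  refine (LipschitzWith.of_dist_le_mul (K := 1) fun f g => ?_).continuous
  rw [dist_eq_norm, dist_eq_norm, ← primitive_sub, NNReal.coe_one, one_mul]
  exact norm_primitive_le _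

variable {S J₀ : ℕ} {w : Weights}

theorem WaveletBasis.primitive_toL2 (u : WaveletBasis S J₀) (i : Idx J₀) (t : unitInterval) :
    primitive (u.toL2 i) t = ∫ x in (0 : ℝ)..t, u.fn i x := by
  refine intervalIntegral.integral_congr_ae_restrict ?_
  rw [uIoc_of_le t.2.1]
  have h : Ioc 0 (t : ℝ) ⊆ Icc 0 1 := fun x hx => ⟨hx.1.le, hx.2.trans t.2.2⟩
  exact ae_restrict_of_ae_restrict_of_subset h (u.onb.memLp i).coeFn_toLp

/-- The wavelet basis as a Hilbert basis. -/
noncomputable def WaveletBasis.hilbertBasis (u : WaveletBasis S J₀) : HilbertBasis (Idx J₀) ℝ L2 :=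
  HilbertBasis.mk u.onb.orthonormal u.onb.complete.ge

theorem WaveletBasis.hilbertBasis_apply (u : WaveletBasis S J₀) (i : Idx J₀) :
    u.hilbertBasis i = u.toL2 i := by
  simp [WaveletBasis.hilbertBasis, WaveletBasis.toL2]

theorem WaveletBasis.norm_toL2 (u : WaveletBasis S J₀) (i : Idx J₀) : ‖u.toL2 i‖ = 1 :=
  u.onb.orthonormal.1 i

/-! ### The space `M₀(w)` -/

theorem M0.abs_apply_le (x : M0 J₀ w) (i : Idx J₀) : |x i| ≤ w i.1 * ‖x‖ := by
  have h : |x i| / w i.1 ≤ ‖x‖ := le_ciSup x.bddAbove i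
  rwa [div_le_iff₀ (w.pos _), mul_comm] at h

theorem WaveletBasis.toM0_sub (u : WaveletBasis S J₀) (f g : L2) :
    u.toM0 w (f - g) = u.toM0 w f - u.toM0 w g := by
  refine Subtype.ext (funext fun i => ?_)
  change u.coeff (f - g) i = u.coeff f i - u.coeff g i
  simp_rw [u.coeff_eq_inner, inner_sub_right]

theorem WaveletBasis.toM0_smul (u : WaveletBasis S J₀) (c : ℝ) (f : L2) :
    u.toM0 w (c • f) = c • u.toM0 w f := by
  refine Subtype.ext (funext fun i => ?_)
  change u.coeff (c • f) i = c * u.coeff f i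
  simp_rw [u.coeff_eq_inner, inner_smul_right]

theorem WaveletBasis.norm_toM0_le (u : WaveletBasis S J₀) (f : L2) : ‖u.toM0 w f‖ ≤ ‖f‖ := by
  refine ciSup_le fun i => (div_le_self (abs_nonneg _) (w.one_le _)).trans ?_
  change |u.coeff f i| ≤ _
  rw [u.coeff_eq_inner]
  refine (abs_real_inner_le_norm _ _).trans ?_
  rw [u.norm_toL2, one_mul]

theorem WaveletBasis.continuous_toM0 (u : WaveletBasis S J₀) : Continuous (u.toM0 w) := by
  refine (LipschitzWith.of_dist_le_mul (K := 1) fun f g => ?_).continuous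
  rw [dist_eq_norm, dist_eq_norm, ← u.toM0_sub, NNReal.coe_one, one_mul]
  exact u.norm_toM0_le _

/-! ### Integration of wavelet series -/

/-- The contribution of one level to the primitive of a wavelet series. -/
noncomputable def WaveletBasis.levelPrimitive (u : WaveletBasis S J₀) (x : M0 J₀ w) (j : ℕ) : C01 :=
  ∑ k, x ⟨j, k⟩ • primitive (u.toL2 ⟨j, k⟩)

/-- The primitive `∑ₗ ∑ₖ x_{lk} ∫₀ᵗ ψ_{lk}` of a wavelet series with coefficients in `M₀(w)`. -/
noncomputable def WaveletBasis.seriesPrimitive (u : WaveletBasis S J₀) (x : M0 J₀ w) : C01 :=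
  ∑' j, u.levelPrimitive x j

theorem WaveletBasis.levelPrimitive_apply (u : WaveletBasis S J₀) (x : M0 J₀ w) (j : ℕ)
    (t : unitInterval) :
    u.levelPrimitive x j t = ∑ k, x ⟨j, k⟩ * inner ℝ (u.toL2 ⟨j, k⟩) (ind t) := by
  simp [WaveletBasis.levelPrimitive, ContinuousMap.sum_apply, primitive_apply_eq_inner,
    real_inner_comm]

theorem WaveletBasis.levelPrimitive_sub (u : WaveletBasis S J₀) (x y : M0 J₀ w) (j : ℕ) :
    u.levelPrimitive (x - y) j = u.levelPrimitive x j - u.levelPrimitive y j := by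
  rw [levelPrimitive, levelPrimitive, levelPrimitive, ← Finset.sum_sub_distrib]
  exact Finset.sum_congr rfl fun k _ => sub_smul (x ⟨j, k⟩) (y ⟨j, k⟩) _

theorem WaveletBasis.levelPrimitive_smul (u : WaveletBasis S J₀) (c : ℝ) (x : M0 J₀ w) (j : ℕ) :
    u.levelPrimitive (c • x) j = c • u.levelPrimitive x j := by
  rw [levelPrimitive, levelPrimitive, Finset.smul_sum]
  exact Finset.sum_congr rfl fun k _ => (mul_smul c (x ⟨j, k⟩) _)

/-- Pairing of `ℓ^∞` with `ℓ¹` in `k`: the coefficients are at most `w j * ‖x‖`, and the primitives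
are summed in absolute value at each `t`. -/
theorem WaveletBasis.norm_levelPrimitive_le (u : WaveletBasis S J₀) {j : ℕ} {B : ℝ}
    (hB : ∀ t : unitInterval, ∑ k, |primitive (u.toL2 ⟨j, k⟩) t| ≤ B) (x : M0 J₀ w) :
    ‖u.levelPrimitive x j‖ ≤ w j * B * ‖x‖ := by
  have hB0 : 0 ≤ B := (Finset.sum_nonneg fun _ _ => abs_nonneg _).trans (hB 0)
  have hw := (w.pos j).le
  refine (ContinuousMap.norm_le _ (by positivity)).2 fun t => ?_
  rw [WaveletBasis.levelPrimitive, ContinuousMap.sum_apply]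
  calc ‖∑ k, (x ⟨j, k⟩ • primitive (u.toL2 ⟨j, k⟩)) t‖
      ≤ ∑ k, w j * ‖x‖ * |primitive (u.toL2 ⟨j, k⟩) t| := by
        refine norm_sum_le_of_le _ fun k _ => ?_
        rw [ContinuousMap.smul_apply, smul_eq_mul, norm_mul, Real.norm_eq_abs, Real.norm_eq_abs]
        gcongr
        exact x.abs_apply_le _
    _ ≤ w j * ‖x‖ * B := by rw [← Finset.mul_sum]; gcongr; exact hB t
    _ = _ := by ring

/-- Here the weight condition meets the wavelet bound. Convergence of the series in `C01` and its
Lipschitz constant both come from this majorant. -/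
theorem WaveletBasis.exists_summable_bound (u : WaveletBasis S J₀)
    (hw : Summable fun j : ℕ => w j * (2 : ℝ) ^ (-(lev J₀ j) / 2)) :
    ∃ b : ℕ → ℝ, Summable b ∧ ∀ (x : M0 J₀ w) j, ‖u.levelPrimitive x j‖ ≤ b j * ‖x‖ := by
  obtain ⟨A, hA⟩ := u.hasPrimitiveBound
  have hlev : ∀ j : ℕ, lev J₀ (j + 1) = ((J₀ + j : ℕ) : ℝ) := fun j => by
    unfold lev; push_cast; ring
  -- Index 0 holds the finitely many scaling functions, which `HasPrimitiveBound` leaves out; each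
  -- has a primitive bounded by its `L²` norm 1, so their number is a bound.
  let B : ℕ → ℝ := fun j =>
    if j = 0 then (Fintype.card (Fin (2 ^ (J₀ + (0 - 1)))) : ℝ)
    else A * (2 : ℝ) ^ (-(lev J₀ j) / 2)
  refine ⟨fun j => w j * B j, ?_, fun x j => u.norm_levelPrimitive_le (fun t => ?_) x⟩
  · rw [← summable_nat_add_iff 1]
    refine (((summable_nat_add_iff 1).2 hw).mul_left (A : ℝ)).congr fun j => ?_
    simp only [B, Nat.add_eq_zero_iff, one_ne_zero, and_false, if_false]
    ring
  · rcases j with _ | j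
    · simp only [B, if_true]
      rw [← mul_one (Fintype.card _ : ℝ), ← nsmul_eq_mul]
      refine Finset.sum_le_card_nsmul _ _ _ fun k _ => ?_
      have h := ((primitive (u.toL2 ⟨0, k⟩)).norm_coe_le_norm t).trans (norm_primitive_le _)
      rwa [u.norm_toL2] at h
    · simp only [B, Nat.add_eq_zero_iff, one_ne_zero, and_false, if_false]
      have h := hA j t t.2
      have hr : (0 : ℝ) ≤ (2 : ℝ) ^ (-(lev J₀ (j + 1)) / 2) := by positivity
      simp_rw [← u.primitive_toL2, Real.enorm_eq_ofReal_abs] at h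
      rw [← ENNReal.ofReal_sum_of_nonneg fun _ _ => abs_nonneg _, ← ENNReal.ofReal_coe_nnreal,
        ← ENNReal.ofReal_mul A.coe_nonneg, ← hlev] at h
      exact (ENNReal.ofReal_le_ofReal_iff (mul_nonneg A.2 hr)).1 h

theorem WaveletBasis.hasSum_seriesPrimitive (u : WaveletBasis S J₀)
    (hw : Summable fun j : ℕ => w j * (2 : ℝ) ^ (-(lev J₀ j) / 2))
    (x : M0 J₀ w) :
    HasSum (u.levelPrimitive x) (u.seriesPrimitive x) := by
  obtain ⟨b, hb, h⟩ := u.exists_summable_bound hw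
  exact (Summable.of_norm_bounded (hb.mul_right ‖x‖) (h x)).hasSum

theorem WaveletBasis.seriesPrimitive_sub (u : WaveletBasis S J₀)
    (hw : Summable fun j : ℕ => w j * (2 : ℝ) ^ (-(lev J₀ j) / 2))
    (x y : M0 J₀ w) :
    u.seriesPrimitive (x - y) = u.seriesPrimitive x - u.seriesPrimitive y := by
  refine (u.hasSum_seriesPrimitive hw _).unique ?_
  rw [funext (u.levelPrimitive_sub x y)]
  exact (u.hasSum_seriesPrimitive hw x).sub (u.hasSum_seriesPrimitive hw y)

theorem WaveletBasis.seriesPrimitive_smul (u : WaveletBasis S J₀)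
    (hw : Summable fun j : ℕ => w j * (2 : ℝ) ^ (-(lev J₀ j) / 2))
    (c : ℝ) (x : M0 J₀ w) :
    u.seriesPrimitive (c • x) = c • u.seriesPrimitive x := by
  refine (u.hasSum_seriesPrimitive hw _).unique ?_
  rw [funext (u.levelPrimitive_smul c x)]
  exact (u.hasSum_seriesPrimitive hw x).const_smul c

theorem WaveletBasis.exists_lipschitzWith_seriesPrimitive (u : WaveletBasis S J₀)
    (hw : Summable fun j : ℕ => w j * (2 : ℝ) ^ (-(lev J₀ j) / 2)) :
    ∃ K : ℝ≥0, LipschitzWith K (u.seriesPrimitive : M0 J₀ w → C01) := by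
  obtain ⟨b, hb, h⟩ := u.exists_summable_bound hw
  refine ⟨(∑' j, b j).toNNReal, LipschitzWith.of_dist_le_mul fun x y => ?_⟩
  rw [dist_eq_norm, dist_eq_norm, ← u.seriesPrimitive_sub hw]
  have h1 : ‖u.seriesPrimitive (x - y)‖ ≤ (∑' j, b j) * ‖x - y‖ :=
    tsum_of_norm_bounded (hb.hasSum.mul_right ‖x - y‖) (h (x - y))
  exact h1.trans (mul_le_mul_of_nonneg_right (Real.le_coe_toNNReal _) (norm_nonneg _))

theorem WaveletBasis.hasSum_seriesPrimitive_apply (u : WaveletBasis S J₀)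
    (hw : Summable fun j : ℕ => w j * (2 : ℝ) ^ (-(lev J₀ j) / 2))
    (x : M0 J₀ w) (t : unitInterval) :
    HasSum (fun j => ∑ k, x ⟨j, k⟩ * inner ℝ (u.toL2 ⟨j, k⟩) (ind t)) (u.seriesPrimitive x t) := by
  simp_rw [← u.levelPrimitive_apply]
  exact (u.hasSum_seriesPrimitive hw x).map (ContinuousMap.evalCLM ℝ t)
    (ContinuousMap.evalCLM ℝ t).continuous

/-- Parseval's identity for `f` and `ind t`, its unconditionally convergent sum being grouped by
levels. -/
theorem WaveletBasis.seriesPrimitive_toM0 (u : WaveletBasis S J₀)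
    (hw : Summable fun j : ℕ => w j * (2 : ℝ) ^ (-(lev J₀ j) / 2))
    (f : L2) :
    u.seriesPrimitive (u.toM0 w f) = primitive f := by
  ext t
  refine (u.hasSum_seriesPrimitive_apply hw _ t).unique ?_
  have h := u.hilbertBasis.hasSum_inner_mul_inner f (ind t)
  rw [real_inner_comm, ← primitive_apply_eq_inner] at h
  simp_rw [u.hilbertBasis_apply] at h
  refine (h.sigma fun j => hasSum_fintype _).congr_fun ?_
  intro j
  refine Finset.sum_congr rfl fun k _ => ?_
  change u.coeff f ⟨j, k⟩ * _ = _
  rw [u.coeff_eq_inner, real_inner_comm]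

/-! ### The bounded-Lipschitz metric under Lipschitz maps -/

section BL

variable {E E' : Type*} [PseudoMetricSpace E] [PseudoMetricSpace E']

theorem blDist_nonneg [MeasurableSpace E] (μ ν : Measure E) : 0 ≤ blDist μ ν :=
  Real.iSup_nonneg fun _ => abs_nonneg _

theorem IsBLUnit.abs_integral_le_one [MeasurableSpace E] {F : E → ℝ} (hF : IsBLUnit F) (μ : Measure E)
    [IsProbabilityMeasure μ] : |∫ x, F x ∂μ| ≤ 1 := by
  obtain ⟨a, b, hab, ha, -⟩ := hF
  have h : ‖∫ x, F x ∂μ‖ ≤ a * μ.real univ := norm_integral_le_of_norm_le_const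
    (Eventually.of_forall ha)
  have h1 : (a : ℝ) ≤ 1 := by exact_mod_cast le_self_add.trans hab
  simpa using h.trans (by simpa using h1)

theorem IsBLUnit.le_blDist [MeasurableSpace E] {F : E → ℝ} (hF : IsBLUnit F) (μ ν : Measure E)
    [IsProbabilityMeasure μ] [IsProbabilityMeasure ν] :
    |∫ x, F x ∂μ - ∫ x, F x ∂ν| ≤ blDist μ ν := by
  -- A real supremum dominates its terms only if the family is bounded; 2 works because both
  -- integrals are at most 1 in absolute value.
  refine le_ciSup (f := fun F : {F : E → ℝ // IsBLUnit F} => |∫ x, F.1 x ∂μ - ∫ x, F.1 x ∂ν|)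
    ⟨2, ?_⟩ ⟨F, hF⟩
  rintro _ ⟨G, rfl⟩
  refine (abs_sub _ _).trans ?_
  linarith [G.2.abs_integral_le_one μ, G.2.abs_integral_le_one ν]

/-- Composition multiplies the Lipschitz constant by `K` but leaves the bound on `|F|` alone, hence
the normalisation by `max 1 K` rather than `K`. -/
theorem IsBLUnit.comp_lipschitz {F : E' → ℝ} (hF : IsBLUnit F) {g : E → E'} {K : ℝ≥0}
    (hg : LipschitzWith K g) : IsBLUnit fun x => ((max 1 K)⁻¹ : ℝ≥0) * F (g x) := by
  obtain ⟨a, b, hab, ha, hb⟩ := hF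
  have hM : 0 < max 1 K := lt_of_lt_of_le one_pos (le_max_left _ _)
  have hM1 : (max 1 K)⁻¹ ≤ 1 := inv_le_one_of_one_le₀ (le_max_left _ _)
  have hMK : (max 1 K)⁻¹ * K ≤ 1 := by
    rw [inv_mul_le_iff₀ hM, mul_one]; exact le_max_right _ _
  refine ⟨(max 1 K)⁻¹ * a, (max 1 K)⁻¹ * (b * K), ?_, fun x => ?_, ?_⟩
  · refine le_trans (add_le_add (mul_le_of_le_one_left a.2 hM1) ?_) hab
    calc (max 1 K)⁻¹ * (b * K) = b * ((max 1 K)⁻¹ * K) := by ring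
      _ ≤ b := mul_le_of_le_one_right b.2 hMK
  · rw [abs_mul, NNReal.abs_eq, NNReal.coe_mul]
    exact mul_le_mul_of_nonneg_left (ha _) (NNReal.coe_nonneg _)
  · refine LipschitzWith.of_dist_le_mul fun x y => ?_
    have h := (hb.comp hg).dist_le_mul x y
    rw [Real.dist_eq] at h ⊢
    rw [← mul_sub, abs_mul, NNReal.abs_eq, NNReal.coe_mul, mul_assoc]
    exact mul_le_mul_of_nonneg_left h (NNReal.coe_nonneg _)

theorem blDist_map_le [MeasurableSpace E] [MeasurableSpace E'] [OpensMeasurableSpace E']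
    (μ ν : Measure E) [IsProbabilityMeasure μ] [IsProbabilityMeasure ν] {g : E → E'} {K : ℝ≥0} (hg : LipschitzWith K g) (hm : Measurable g) :
    blDist (μ.map g) (ν.map g) ≤ (max 1 K : ℝ≥0) * blDist μ ν := by
  refine Real.iSup_le (fun F => ?_) (mul_nonneg (NNReal.coe_nonneg _) (blDist_nonneg _ _))
  have hM : 0 < ((max 1 K : ℝ≥0) : ℝ) := lt_of_lt_of_le one_pos (le_max_left _ _)
  have hF : Measurable F.1 := by
    obtain ⟨a, b, -, -, hb⟩ := F.2
    exact hb.continuous.measurable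
  have h := (F.2.comp_lipschitz hg).le_blDist μ ν
  rw [integral_const_mul, integral_const_mul, ← mul_sub, abs_mul, NNReal.abs_eq, NNReal.coe_inv,
    inv_mul_le_iff₀ hM] at h
  rwa [integral_map hm.aemeasurable hF.aestronglyMeasurable,
    integral_map hm.aemeasurable hF.aestronglyMeasurable]

end BL

theorem tendstoInMeasure_zero_of_le {Ω : Type*} [MeasurableSpace Ω] {P : Measure Ω}
    {f g : ℕ → Ω → ℝ} {M : ℝ} (hM : 0 < M) (hf : TendstoInMeasure P f atTop fun _ => 0)
    (h0 : ∀ n ω, 0 ≤ g n ω) (hg : ∀ n, ∀ᵐ ω ∂P, g n ω ≤ M * f n ω) :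
    TendstoInMeasure P g atTop fun _ => 0 := by
  rw [tendstoInMeasure_iff_norm] at hf ⊢
  intro ε hε
  refine tendsto_of_tendsto_of_tendsto_of_le_of_le tendsto_const_nhds (hf (ε / M) (by positivity))
    (fun _ => zero_le) fun n => measure_mono_ae ?_
  filter_upwards [hg n] with ω hω (h : ε ≤ ‖g n ω - 0‖)
  change ε / M ≤ ‖f n ω - 0‖
  rw [sub_zero, Real.norm_of_nonneg (h0 n ω)] at h
  rw [div_le_iff₀' hM, sub_zero]
  exact h.trans (hω.trans (mul_le_mul_of_nonneg_left (Real.le_norm_self _) hM.le))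

/-! ### Gaussian limits and equality of laws -/

section Gaussian

variable {ι Ω : Type*} [MeasurableSpace Ω] {P : Measure Ω} {X : ι → Ω → ℝ} {c : ι → ι → ℝ}

theorem IsCentredGaussian.charFun_map_sum (hX : IsCentredGaussian X P c) (s : Finset ι)
    (b : ι → ℝ) (ξ : ℝ) :
    charFun (P.map fun ω => ∑ i ∈ s, b i * X i ω) ξ =
      Complex.exp (-(((∑ i ∈ s, ∑ j ∈ s, b i * b j * c i j) * ξ ^ 2 / 2 : ℝ) : ℂ)) := by
  have := hX.gaussian.isProbabilityMeasure
  have hb := hX.gaussian.smul b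
  have hG : HasGaussianLaw (fun ω => ∑ i ∈ s, b i * X i ω) P := hb.hasGaussianLaw_fun_sum
  have hL : ∀ i, MemLp (fun ω => b i * X i ω) 2 P := fun i => (hb.hasGaussianLaw_eval i).memLp_two
  have hmean : P[fun ω => ∑ i ∈ s, b i * X i ω] = 0 := by
    rw [integral_finsetSum _ fun i _ => (hL i).integrable one_le_two]
    refine Finset.sum_eq_zero fun i _ => ?_
    rw [integral_const_mul, hX.centred, mul_zero]
  have hvar : Var[fun ω => ∑ i ∈ s, b i * X i ω; P] = ∑ i ∈ s, ∑ j ∈ s, b i * b j * c i j := by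
    rw [← covariance_self hG.aemeasurable,
      covariance_fun_sum_fun_sum' (fun i _ => hL i) (fun i _ => hL i)]
    refine Finset.sum_congr rfl fun i _ => Finset.sum_congr rfl fun j _ => ?_
    rw [covariance_const_mul_left, covariance_const_mul_right, hX.cov_eq, mul_assoc]
  rw [hG.map_eq_gaussianReal, charFun_gaussianReal, hmean, hvar, Real.coe_toNNReal]
  · push_cast
    ring_nf
  · rw [← hvar]
    exact variance_nonneg _ _

/-- Limits of linear combinations of a centred Gaussian process whose covariance is given by a
continuous bilinear form. -/
theorem IsCentredGaussian.charFun_map_of_tendsto {H : Type*} [NormedAddCommGroup H]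
    [NormedSpace ℝ H] (hX : IsCentredGaussian X P c) (B : H →L[ℝ] H →L[ℝ] ℝ) (e : ι → H)
    (hc : ∀ i j, c i j = B (e i) (e j)) {s : ℕ → Finset ι} {b : ι → ℝ} {h : H}
    (hs : Tendsto (fun n => ∑ i ∈ s n, b i • e i) atTop (𝓝 h)) {Z : Ω → ℝ}
    (hZ : ∀ᵐ ω ∂P, Tendsto (fun n => ∑ i ∈ s n, b i * X i ω) atTop (𝓝 (Z ω))) (ξ : ℝ) :
    charFun (P.map Z) ξ = Complex.exp (-((B h h * ξ ^ 2 / 2 : ℝ) : ℂ)) := by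
  have := hX.gaussian.isProbabilityMeasure
  have hS : ∀ n, AEMeasurable (fun ω => ∑ i ∈ s n, b i * X i ω) P := fun n =>
    Finset.aemeasurable_fun_sum _ fun i _ => (hX.gaussian.aemeasurable i).const_mul _
  have hZm : AEMeasurable Z P := aemeasurable_of_tendsto_metrizable_ae' hS hZ
  have hchar : ∀ Y : Ω → ℝ, AEMeasurable Y P →
      charFun (P.map Y) ξ = ∫ ω, Complex.exp (ξ * Y ω * Complex.I) ∂P := fun Y hY => by
    rw [charFun_apply_real, integral_map hY (by fun_prop)]
  have hq : ∀ n, ∑ i ∈ s n, ∑ j ∈ s n, b i * b j * c i j =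
      B (∑ i ∈ s n, b i • e i) (∑ i ∈ s n, b i • e i) := fun n => by
    simp only [map_sum, map_smul, sum_apply, smul_apply,
      smul_eq_mul, hc]
    rw [Finset.sum_comm]
    refine Finset.sum_congr rfl fun i _ => ?_
    rw [Finset.mul_sum]
    exact Finset.sum_congr rfl fun j _ => by ring
  -- The characteristic functions of the partial sums have two limits: by dominated convergence that
  -- of `Z`, and by continuity of `B` the Gaussian one with variance `B h h`.
  refine tendsto_nhds_unique
    (f := fun n => charFun (P.map fun ω => ∑ i ∈ s n, b i * X i ω) ξ) (l := atTop) ?_ ?_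
  · rw [hchar Z hZm]
    simp_rw [fun n => hchar _ (hS n)]
    refine tendsto_integral_of_dominated_convergence (fun _ => 1) (fun n => ?_)
      (integrable_const _) (fun n => Eventually.of_forall fun ω => ?_) ?_
    · have := hS n
      exact AEMeasurable.aestronglyMeasurable (by fun_prop)
    · rw [← Complex.ofReal_mul, Complex.norm_exp_ofReal_mul_I]
    · filter_upwards [hZ] with ω hω
      exact ((Complex.continuous_exp.comp (by fun_prop :
        Continuous fun z : ℝ => (ξ * z * Complex.I : ℂ))).tendsto (Z ω)).comp hω
  · simp_rw [hX.charFun_map_sum, hq]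
    exact ((by fun_prop : Continuous fun g : H =>
      Complex.exp (-((B g g * ξ ^ 2 / 2 : ℝ) : ℂ))).tendsto h).comp hs

/-- Two processes all of whose linear combinations have the same law have the same finite
dimensional distributions. -/
theorem map_restrict_eq_of_charFun {Ω' : Type*} [MeasurableSpace Ω'] {P' : Measure Ω'}
    {Y : ι → Ω' → ℝ} [IsProbabilityMeasure P] [IsProbabilityMeasure P']
    (hX : ∀ i, AEMeasurable (X i) P) (hY : ∀ i, AEMeasurable (Y i) P')
    (h : ∀ (I : Finset ι) (b : ι → ℝ), charFun (P.map fun ω => ∑ i ∈ I, b i * X i ω) 1 =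
      charFun (P'.map fun ω => ∑ i ∈ I, b i * Y i ω) 1) (I : Finset ι) :
    P.map (fun ω => I.restrict (X · ω)) = P'.map (fun ω => I.restrict (Y · ω)) := by
  classical
  have hX' : AEMeasurable (fun ω => I.restrict (X · ω)) P := aemeasurable_pi_lambda _ fun i => hX i
  have hY' : AEMeasurable (fun ω => I.restrict (Y · ω)) P' := aemeasurable_pi_lambda _ fun i => hY i
  have := Measure.isProbabilityMeasure_map hX'
  have := Measure.isProbabilityMeasure_map hY'
  refine Measure.ext_of_charFunDual (funext fun L => ?_)
  -- Cramér–Wold: the coefficients of the functional `L`, extended by zero off `I`.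
  let b : ι → ℝ := fun i => if hi : i ∈ I then L (Pi.single ⟨i, hi⟩ 1) else 0
  have hL : ∀ z : ι → ℝ, L (I.restrict z) = ∑ i ∈ I, b i * z i := fun z => by
    have h1 : I.restrict z = ∑ i : I, z i • Pi.single i (1 : ℝ) := by
      rw [pi_eq_sum_univ' (I.restrict z)]
      refine Finset.sum_congr rfl fun i _ => ?_
      congr 1
    rw [h1, map_sum, ← Finset.sum_coe_sort I]
    refine Finset.sum_congr rfl fun i _ => ?_
    rw [map_smul, smul_eq_mul, mul_comm]
    simp [b]
  rw [charFunDual_eq_charFun_map_one, charFunDual_eq_charFun_map_one,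
    AEMeasurable.map_map_of_aemeasurable (by fun_prop) hX',
    AEMeasurable.map_map_of_aemeasurable (by fun_prop) hY']
  simp only [Function.comp_def, hL]
  exact h I b

end Gaussian

/-! ### Laws on `C([0,1])` -/

/-- By separability the open balls generate the Borel sets. By continuity a closed ball is cut out
by countably many evaluations at dense points, and an open ball is a countable union of closed balls
with rational radii. -/
theorem borel_C01_le_comap :
    borel C01 ≤ MeasurableSpace.comap (fun (g : C01) (t : unitInterval) => g t)
      MeasurableSpace.pi := by
  set m := MeasurableSpace.comap (fun (g : C01) (t : unitInterval) => g t) MeasurableSpace.pi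
  have hbasis : TopologicalSpace.IsTopologicalBasis
      {s : Set C01 | ∃ g r, s = Metric.ball g r} := by
    refine TopologicalSpace.isTopologicalBasis_of_isOpen_of_nhds ?_ fun g U hg hU => ?_
    · rintro _ ⟨g, r, rfl⟩
      exact Metric.isOpen_ball
    · obtain ⟨r, hr, h⟩ := Metric.isOpen_iff.1 hU g hg
      exact ⟨_, ⟨g, r, rfl⟩, Metric.mem_ball_self hr, h⟩
  have heval : ∀ t : unitInterval, Measurable[m] fun g : C01 => g t := fun t =>
    (measurable_pi_apply t).comp (comap_measurable _)
  have hclosed : ∀ (g : C01) (r : ℝ), 0 ≤ r → MeasurableSet[m] (Metric.closedBall g r) := by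
    intro g r hr
    have : Metric.closedBall g r =
        ⋂ n, {h : C01 | dist (h (TopologicalSpace.denseSeq unitInterval n))
          (g (TopologicalSpace.denseSeq unitInterval n)) ≤ r} := by
      ext h
      rw [Metric.mem_closedBall, ContinuousMap.dist_le hr, mem_iInter]
      refine ⟨fun H n => H _, fun H t => ?_⟩
      refine (TopologicalSpace.denseRange_denseSeq unitInterval).induction_on t ?_ H
      exact isClosed_le (by fun_prop) continuous_const
    rw [this]
    refine MeasurableSet.iInter fun n => ?_
    exact measurableSet_le ((heval _).dist measurable_const) measurable_const
  rw [hbasis.borel_eq_generateFrom]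
  refine MeasurableSpace.generateFrom_le ?_
  rintro _ ⟨g, r, rfl⟩
  have : Metric.ball g r = ⋃ q : {q : ℚ // 0 ≤ (q : ℝ) ∧ (q : ℝ) < r},
      Metric.closedBall g (q.1 : ℝ) := by
    ext h
    simp only [Metric.mem_ball, mem_iUnion, Metric.mem_closedBall]
    refine ⟨fun H => ?_, fun ⟨q, hq⟩ => hq.trans_lt q.2.2⟩
    obtain ⟨q, h1, h2⟩ := exists_rat_btwn H
    exact ⟨⟨q, dist_nonneg.trans h1.le, h2⟩, h1.le⟩
  rw [this]
  exact MeasurableSet.iUnion fun q => hclosed g _ q.2.1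

theorem measurable_C01_coe : Measurable fun (g : C01) (t : unitInterval) => g t :=
  measurable_pi_lambda _ fun t => (ContinuousEvalConst.continuous_eval_const t).measurable

/-- The images on the product space are projective limits of the same family, hence equal, and every
Borel set of `C01` is a preimage from that space. -/
theorem C01.measure_ext {μ ν : Measure C01} [IsProbabilityMeasure μ] [IsProbabilityMeasure ν]
    (h : ∀ I : Finset unitInterval, μ.map (fun g => I.restrict fun t => g t) =
      ν.map (fun g => I.restrict fun t => g t)) : μ = ν := by
  have hμ := isProjectiveLimit_map (P := μ) (X := fun (t : unitInterval) (g : C01) => g t)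
    measurable_C01_coe.aemeasurable
  have hν := isProjectiveLimit_map (P := ν) (X := fun (t : unitInterval) (g : C01) => g t)
    measurable_C01_coe.aemeasurable
  have key : μ.map (fun (g : C01) (t : unitInterval) => g t) =
      ν.map (fun (g : C01) (t : unitInterval) => g t) := by
    simp_rw [h] at hμ
    have : ∀ I : Finset unitInterval,
        IsFiniteMeasure (ν.map (fun g => I.restrict fun t => g t)) := fun I => inferInstance
    exact hμ.unique hν
  ext A hA
  obtain ⟨A', hA', rfl⟩ := borel_C01_le_comap A hA
  rw [← Measure.map_apply measurable_C01_coe hA', key, Measure.map_apply measurable_C01_coe hA']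

/-! ### Partial sums over levels -/

/-- The indices of the first `n` levels. -/
def levelFinset (J₀ n : ℕ) : Finset (Idx J₀) := (Finset.range n).sigma fun _ => Finset.univ

theorem tendsto_levelFinset : Tendsto (levelFinset J₀) atTop atTop := by
  refine tendsto_atTop_finset_of_monotone (fun m n h => ?_) fun i => ⟨i.1 + 1, ?_⟩
  · exact Finset.sigma_mono (Finset.range_mono h) fun _ => le_rfl
  · simp [levelFinset]

theorem WaveletBasis.tendsto_levelFinset_sum (u : WaveletBasis S J₀) (h : L2) :
    Tendsto (fun n => ∑ i ∈ levelFinset J₀ n, (inner ℝ (u.toL2 i) h : ℝ) • u.toL2 i) atTop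
      (𝓝 h) := by
  have := (u.hilbertBasis.hasSum_repr h).comp tendsto_levelFinset
  simpa only [Function.comp_def, HilbertBasis.repr_apply_apply, u.hilbertBasis_apply] using this

theorem WaveletBasis.tendsto_levelFinset_seriesPrimitive (u : WaveletBasis S J₀)
    (hw : Summable fun j : ℕ => w j * (2 : ℝ) ^ (-(lev J₀ j) / 2))
    (x : M0 J₀ w)
    (t : unitInterval) :
    Tendsto (fun n => ∑ i ∈ levelFinset J₀ n, inner ℝ (u.toL2 i) (ind t) * x i) atTop
      (𝓝 (u.seriesPrimitive x t)) := by
  refine ((u.hasSum_seriesPrimitive_apply hw x t).tendsto_sum_nat).congr fun n => ?_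
  rw [levelFinset, Finset.sum_sigma]
  exact Finset.sum_congr rfl fun j _ => Finset.sum_congr rfl fun k _ => mul_comm _ _

/-- The image under integration of a centred Gaussian law on `M₀(w)`. -/
theorem WaveletBasis.map_seriesPrimitive_eq (u : WaveletBasis S J₀)
    (hw : Summable fun j : ℕ => w j * (2 : ℝ) ^ (-(lev J₀ j) / 2))
    (B : L2 →L[ℝ] L2 →L[ℝ] ℝ) {c : Idx J₀ → Idx J₀ → ℝ}
    (hc : ∀ i j, c i j = B (u.toL2 i) (u.toL2 j))
    {c' : unitInterval → unitInterval → ℝ} (hc' : ∀ s t, c' s t = B (ind s) (ind t))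
    {𝒩 : Measure (M0 J₀ w)} (h𝒩 : IsCentredGaussian (fun i (x : M0 J₀ w) => x i) 𝒩 c)
    {γ : Measure C01} (hγ : IsCentredGaussian (fun (t : unitInterval) (g : C01) => g t) γ c') :
    𝒩.map u.seriesPrimitive = γ := by
  have := h𝒩.gaussian.isProbabilityMeasure
  have := hγ.gaussian.isProbabilityMeasure
  obtain ⟨K, hK⟩ := u.exists_lipschitzWith_seriesPrimitive hw
  have hm : Measurable (u.seriesPrimitive : M0 J₀ w → C01) := hK.continuous.measurable
  have := Measure.isProbabilityMeasure_map (μ := 𝒩) hm.aemeasurable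
  refine C01.measure_ext fun I => ?_
  have heval : ∀ t : unitInterval, Measurable fun g : C01 => g t := fun t =>
    (ContinuousEvalConst.continuous_eval_const t).measurable
  have hIm : Measurable fun g : C01 => I.restrict fun t => g t :=
    measurable_pi_lambda _ fun t => heval t
  rw [Measure.map_map hIm hm]
  refine map_restrict_eq_of_charFun (X := fun t (x : M0 J₀ w) => u.seriesPrimitive x t)
    (Y := fun t (g : C01) => g t)
    (fun t => ((heval t).comp hm).aemeasurable) (fun t => (heval t).aemeasurable) (fun I a => ?_) I
  -- The vector `h` represents the linear combination on both sides: exactly for `γ`, and as the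
  -- limit of its wavelet expansion for `𝒩`. Both variances are therefore `B h h`.
  set h : L2 := ∑ t ∈ I, a t • ind t
  rw [hγ.charFun_map_of_tendsto B ind hc' (s := fun _ => I) (b := a) (h := h) tendsto_const_nhds
      (Eventually.of_forall fun _ => tendsto_const_nhds),
    h𝒩.charFun_map_of_tendsto B u.toL2 hc (u.tendsto_levelFinset_sum h)
      (Eventually.of_forall fun x => ?_)]
  have := tendsto_finsetSum I fun t _ =>
    (u.tendsto_levelFinset_seriesPrimitive hw x t).const_mul (a t)
  refine this.congr fun n => ?_
  simp_rw [Finset.mul_sum]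
  rw [Finset.sum_comm]
  refine Finset.sum_congr rfl fun i _ => ?_
  rw [inner_sum, Finset.sum_mul]
  refine Finset.sum_congr rfl fun t _ => ?_
  rw [inner_smul_right, mul_assoc]

/-! ### Transfer of the weak Bernstein-von Mises phenomenon -/

section Transfer

variable {Ω : Type*} [MeasurableSpace Ω] {P : Measure Ω}

theorem kolmogorovSmirnovLimit_of_functionalLimit {post : ℕ → Ω → Measure L2}
    (hpost : ∀ n ω, IsProbabilityMeasure (post n ω)) {TT : ℕ → Ω → C01} {γ : Measure C01}
    [IsProbabilityMeasure γ] (h : FunctionalLimit P post TT γ) :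
    KolmogorovSmirnovLimit P post TT γ := by
  refine tendstoInMeasure_zero_of_le one_pos h (fun _ _ => blDist_nonneg _ _)
    fun n => Eventually.of_forall fun ω => ?_
  have := hpost n ω
  have hm : Measurable fun f : L2 => √(n : ℝ) • (primitive f - TT n ω) :=
    Continuous.measurable <| by have := continuous_primitive; fun_prop
  have := Measure.isProbabilityMeasure_map (μ := post n ω) hm.aemeasurable
  have hn : Measurable fun g : C01 => ‖g‖ := continuous_norm.measurable
  have key := blDist_map_le ((post n ω).map fun f => √(n : ℝ) • (primitive f - TT n ω)) γ
    (lipschitzWith_one_norm (E := C01)) hn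
  rw [Measure.map_map hn hm, max_self] at key
  simpa only [Function.comp_def, norm_smul, Real.norm_of_nonneg (Real.sqrt_nonneg _),
    NNReal.coe_one] using key

/-- The common core of both models, which enter only through `B` and through the primitive `TT` of
the centring. -/
theorem WeakBvM.functionalLimit {u : WaveletBasis S J₀}
    (hw : Summable fun j : ℕ => w j * (2 : ℝ) ^ (-(lev J₀ j) / 2))
    {post : ℕ → Ω → Measure L2} (hpost : ∀ n ω, IsProbabilityMeasure (post n ω))
    {T : ℕ → Ω → M0 J₀ w} {c : Idx J₀ → Idx J₀ → ℝ} (hBvM : WeakBvM u w P post T c)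
    (B : L2 →L[ℝ] L2 →L[ℝ] ℝ) (hc : ∀ i j, c i j = B (u.toL2 i) (u.toL2 j))
    {c' : unitInterval → unitInterval → ℝ} (hc' : ∀ s t, c' s t = B (ind s) (ind t))
    {γ : Measure C01} (hγ : IsCentredGaussian (fun (t : unitInterval) (g : C01) => g t) γ c')
    {TT : ℕ → Ω → C01} (hT : ∀ n, ∀ᵐ ω ∂P, u.seriesPrimitive (T n ω) = TT n ω) :
    FunctionalLimit P post TT γ := by
  obtain ⟨-, 𝒩, h𝒩p, h𝒩, hlim⟩ := hBvM
  obtain ⟨K, hK⟩ := u.exists_lipschitzWith_seriesPrimitive hw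
  have hLm : Measurable (u.seriesPrimitive : M0 J₀ w → C01) := hK.continuous.measurable
  have hM : 0 < ((max 1 K : ℝ≥0) : ℝ) := lt_of_lt_of_le one_pos (le_max_left _ _)
  refine tendstoInMeasure_zero_of_le hM hlim (fun _ _ => blDist_nonneg _ _) fun n => ?_
  filter_upwards [hT n] with ω hω
  have := hpost n ω
  have hm : Measurable fun f : L2 => √(n : ℝ) • (u.toM0 w f - T n ω) := by
    simp_rw [smul_sub, ← u.toM0_smul]
    exact ((u.continuous_toM0.comp (continuous_const_smul _)).sub continuous_const).measurable
  have := Measure.isProbabilityMeasure_map (μ := post n ω) hm.aemeasurable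
  have key := blDist_map_le ((post n ω).map fun f => √(n : ℝ) • (u.toM0 w f - T n ω)) 𝒩 hK hLm
  rw [u.map_seriesPrimitive_eq hw B hc hc' h𝒩 hγ, Measure.map_map hLm hm] at key
  simpa only [Function.comp_def, u.seriesPrimitive_smul hw, u.seriesPrimitive_sub hw,
    u.seriesPrimitive_toM0 hw, hω] using key

end Transfer

/-! ### White noise -/

/-- Needed to carry membership in `m0 J₀ w` from one sequence to another with the same law. -/
theorem measurableSet_m0 : MeasurableSet (m0 J₀ w : Set (Idx J₀ → ℝ)) := by
  have : (m0 J₀ w : Set (Idx J₀ → ℝ)) = ⋂ m : ℕ, ⋃ J : ℕ, ⋂ j : ℕ, ⋂ _ : J ≤ j,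
      ⋂ k : Fin (2 ^ (J₀ + (j - 1))), {x | |x ⟨j, k⟩| / w j ≤ 1 / ((m : ℝ) + 1)} := by
    ext x
    simp only [mem_iInter, mem_iUnion, Set.mem_ofPred_eq]
    refine ⟨fun h m => eventually_atTop.1 (h _ (by positivity)), fun h ε hε => ?_⟩
    obtain ⟨m, hm⟩ := exists_nat_one_div_lt hε
    filter_upwards [eventually_atTop.2 (h m)] with j hj k
    exact (hj k).trans hm.le
  rw [this]
  refine MeasurableSet.iInter fun m => MeasurableSet.iUnion fun J => MeasurableSet.iInter fun j =>
    MeasurableSet.iInter fun _ => MeasurableSet.iInter fun k => ?_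
  exact measurableSet_le (by fun_prop) measurable_const

section WhiteNoise

variable {Ω : Type*} [MeasurableSpace Ω] {P : Measure Ω}

theorem IsCentredGaussian.comp_right {T T' : Type*} {X : T → Ω → ℝ} {c : T → T → ℝ}
    (hX : IsCentredGaussian X P c) (f : T' → T) :
    IsCentredGaussian (fun t => X (f t)) P fun s t => c (f s) (f t) :=
  ⟨hX.gaussian.comp_right f, fun _ => hX.centred _, fun _ _ => hX.cov_eq _ _⟩

/-- A Gaussian sequence belongs to `M₀(w)` almost surely if its covariance is that of a law on
`M₀(w)`. -/
theorem ae_mem_m0 {X : Idx J₀ → Ω → ℝ} {c : Idx J₀ → Idx J₀ → ℝ} (hX : IsCentredGaussian X P c)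
    {𝒩 : Measure (M0 J₀ w)} (h𝒩 : IsCentredGaussian (fun i (x : M0 J₀ w) => x i) 𝒩 c) :
    ∀ᵐ ω ∂P, (fun i => X i ω) ∈ m0 J₀ w := by
  have := hX.gaussian.isProbabilityMeasure
  have := h𝒩.gaussian.isProbabilityMeasure
  have hXm : AEMeasurable (fun ω i => X i ω) P := aemeasurable_pi_lambda _ hX.gaussian.aemeasurable
  have hNm : AEMeasurable (fun (x : M0 J₀ w) i => x i) 𝒩 :=
    aemeasurable_pi_lambda _ h𝒩.gaussian.aemeasurable
  have h := map_restrict_eq_of_charFun hX.gaussian.aemeasurable h𝒩.gaussian.aemeasurable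
    fun I b => (hX.charFun_map_sum I b 1).trans (h𝒩.charFun_map_sum I b 1).symm
  have hP := isProjectiveLimit_map hXm
  have hN := isProjectiveLimit_map hNm
  simp_rw [h] at hP
  have : ∀ I : Finset (Idx J₀), IsFiniteMeasure
    (𝒩.map fun (x : M0 J₀ w) => I.restrict fun i => x i) := fun I => inferInstance
  have key := hP.unique hN
  -- The two sequences have equal laws on the product space, and under `𝒩` membership holds at every
  -- point.
  refine ae_of_ae_map (p := fun x => x ∈ m0 J₀ w) hXm ?_
  rw [key]
  exact (ae_map_iff hNm measurableSet_m0).2 (Eventually.of_forall fun x => x.2)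

theorem M0.ofSeq_of_mem {x : Idx J₀ → ℝ} (h : x ∈ m0 J₀ w) : M0.ofSeq w x = ⟨x, h⟩ :=
  dif_pos h

theorem ae_eq_zero_of_charFun [IsProbabilityMeasure P] {Z : Ω → ℝ} (hZ : AEMeasurable Z P)
    (h : ∀ ξ, charFun (P.map Z) ξ = 1) : ∀ᵐ ω ∂P, Z ω = 0 := by
  have := Measure.isProbabilityMeasure_map hZ
  have hd : P.map Z = Measure.dirac 0 := by
    refine Measure.ext_of_charFun (funext fun ξ => ?_)
    rw [h, charFun_dirac]
    simp
  refine ae_of_ae_map (p := fun z => z = 0) hZ ?_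
  rw [hd]
  exact (ae_dirac_iff (p := fun z : ℝ => z = 0) (measurableSet_singleton 0)).2 rfl

/-- The series `∑ᵢ 𝕎(ψᵢ) ∫₀ᵗ ψᵢ` represents `𝕎(1_{[0,t]})`. -/
theorem IsWhiteNoise.ae_seriesPrimitive_eq {u : WaveletBasis S J₀}
    (hw : Summable fun j : ℕ => w j * (2 : ℝ) ^ (-(lev J₀ j) / 2)) {W : L2 → Ω → ℝ}
    (hW : IsWhiteNoise W P) (hmem : ∀ᵐ ω ∂P, (fun i => W (u.toL2 i) ω) ∈ m0 J₀ w)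
    (t : unitInterval) :
    ∀ᵐ ω ∂P, u.seriesPrimitive (M0.ofSeq w fun i => W (u.toL2 i) ω) t = W (ind t) ω := by
  have := hW.gaussian.isProbabilityMeasure
  -- The extra index `none` carries `-𝕎(1_{[0,t]})`. The vectors representing the partial sums of
  -- the difference then tend to `0` in `L2`, so the limit has variance zero.
  let e : Option (Idx J₀) → L2 := fun o => o.elim (ind t) u.toL2
  let b : Option (Idx J₀) → ℝ := fun o => o.elim (-1) fun i => inner ℝ (u.toL2 i) (ind t)
  have hX := hW.comp_right e
  have hlim : Tendsto (fun n => ∑ i ∈ Finset.insertNone (levelFinset J₀ n), b i • e i) atTop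
      (𝓝 0) := by
    simp only [Finset.sum_insertNone, b, e, Option.elim]
    have := (u.tendsto_levelFinset_sum (ind t)).const_add ((-1 : ℝ) • ind t)
    simpa using this
  have hZ : ∀ᵐ ω ∂P, Tendsto
      (fun n => ∑ i ∈ Finset.insertNone (levelFinset J₀ n), b i * W (e i) ω) atTop
      (𝓝 (u.seriesPrimitive (M0.ofSeq w fun i => W (u.toL2 i) ω) t - W (ind t) ω)) := by
    filter_upwards [hmem] with ω hω
    simp only [Finset.sum_insertNone, b, e, Option.elim]
    rw [sub_eq_neg_add, ← neg_one_mul (W (ind t) ω), M0.ofSeq_of_mem hω]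
    exact (u.tendsto_levelFinset_seriesPrimitive hw _ t).const_add _
  have hchar := hX.charFun_map_of_tendsto (innerSL ℝ) e (fun _ _ => rfl) hlim hZ
  have hm : AEMeasurable (fun ω =>
      u.seriesPrimitive (M0.ofSeq w fun i => W (u.toL2 i) ω) t - W (ind t) ω) P :=
    aemeasurable_of_tendsto_metrizable_ae'
      (fun n => Finset.aemeasurable_fun_sum _ fun i _ => (hX.gaussian.aemeasurable i).const_mul _) hZ
  filter_upwards [ae_eq_zero_of_charFun hm fun ξ => by rw [hchar]; simp] with ω hω
  exact sub_eq_zero.1 hω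

/-- For fixed `t` the identity holds off a null set depending on `t`; a countable dense set of times
and continuity of both sides give one null set for all `t`. -/
theorem IsTrajectory.ae_seriesPrimitive_eq {u : WaveletBasis S J₀}
    (hw : Summable fun j : ℕ => w j * (2 : ℝ) ^ (-(lev J₀ j) / 2)) {W : L2 → Ω → ℝ} {f₀ : L2}
    {Y : ℕ → Ω → C01} (hY : IsTrajectory f₀ W P Y) (hW : IsWhiteNoise W P)
    (hmem : ∀ᵐ ω ∂P, (fun i => W (u.toL2 i) ω) ∈ m0 J₀ w) (n : ℕ) :
    ∀ᵐ ω ∂P, u.seriesPrimitive (M0.ofSeq w (whiteNoiseObs u f₀ W n ω)) = Y n ω := by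
  have hall : ∀ᵐ ω ∂P, ∀ m : ℕ,
      u.seriesPrimitive (M0.ofSeq w fun i => W (u.toL2 i) ω)
          (TopologicalSpace.denseSeq unitInterval m)
        = W (ind (TopologicalSpace.denseSeq unitInterval m)) ω ∧
      Y n ω (TopologicalSpace.denseSeq unitInterval m) =
        primitive f₀ (TopologicalSpace.denseSeq unitInterval m) +
          (√(n : ℝ))⁻¹ * W (ind (TopologicalSpace.denseSeq unitInterval m)) ω :=
    ae_all_iff.2 fun m => (hW.ae_seriesPrimitive_eq hw hmem _).and (hY n _)
  filter_upwards [hmem, hall] with ω hω h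
  have hobs : M0.ofSeq w (whiteNoiseObs u f₀ W n ω) =
      u.toM0 w f₀ - (-(√(n : ℝ))⁻¹) • M0.ofSeq w (fun i => W (u.toL2 i) ω) := by
    have hmem' : whiteNoiseObs u f₀ W n ω ∈ m0 J₀ w :=
      (m0 J₀ w).add_mem (u.coeff_mem w f₀) ((m0 J₀ w).smul_mem (√(n : ℝ))⁻¹ hω)
    rw [M0.ofSeq_of_mem hω, M0.ofSeq_of_mem hmem']
    refine Subtype.ext (funext fun i => ?_)
    change u.coeff f₀ i + (√(n : ℝ))⁻¹ * W (u.toL2 i) ω =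
      u.coeff f₀ i - (-(√(n : ℝ))⁻¹) * W (u.toL2 i) ω
    ring
  rw [hobs, u.seriesPrimitive_sub hw, u.seriesPrimitive_smul hw, u.seriesPrimitive_toM0 hw]
  refine DFunLike.coe_injective (Continuous.ext_on
    (TopologicalSpace.denseRange_denseSeq unitInterval) (map_continuous _) (map_continuous _) ?_)
  rintro _ ⟨m, rfl⟩
  rw [(h m).2, ← (h m).1, ContinuousMap.sub_apply, ContinuousMap.smul_apply, smul_eq_mul]
  ring

theorem inner_ind_ind (s t : unitInterval) : (inner ℝ (ind s) (ind t) : ℝ) = min (s : ℝ) t := by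
  have h : ∀ r : unitInterval, (Icc (0 : ℝ) r) ∩ Icc 0 1 = Icc 0 (r : ℝ) := fun r =>
    inter_eq_left.2 fun x hx => ⟨hx.1, hx.2.trans r.2.2⟩
  have hst : Icc (0 : ℝ) t ∩ Icc (0 : ℝ) s = Icc 0 (min (s : ℝ) t) := by
    rw [Icc_inter_Icc, sup_idem, inf_comm]
  rw [ind, L2.inner_indicatorConstLp_one, Measure.restrict_restrict measurableSet_Icc, h]
  have hae : (ind t : ℝ → ℝ) =ᵐ[volume.restrict (Icc (0 : ℝ) s)]
      (Icc (0 : ℝ) t).indicator fun _ => 1 := by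
    refine ae_restrict_of_ae_restrict_of_subset (t := Icc (0 : ℝ) 1)
      (Icc_subset_Icc_right s.2.2) ?_
    exact indicatorConstLp_coeFn
  rw [integral_congr_ae hae, integral_indicator measurableSet_Icc,
    Measure.restrict_restrict measurableSet_Icc, hst]
  rw [setIntegral_const, measureReal_def, Real.volume_Icc, sub_zero, smul_eq_mul, mul_one,
    ENNReal.toReal_ofReal (le_min s.2.1 t.2.1)]

end WhiteNoise

/-! ### The white bridge -/

section Bridge

variable {f₀ : L2}

theorem IsDensity.isProbabilityMeasure (hf : IsDensity f₀) :
    IsProbabilityMeasure (densityLaw f₀) := by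
  refine ⟨?_⟩
  have hi : Integrable f₀ leb01 := f₀.integrableOn
  rw [densityLaw, withDensity_apply _ MeasurableSet.univ, Measure.restrict_univ,
    ← ofReal_integral_eq_lintegral_ofReal hi hf.1, hf.2, ENNReal.ofReal_one]

theorem IsDensity.integral_densityLaw (hf : IsDensity f₀) (g : ℝ → ℝ) :
    ∫ x, g x ∂densityLaw f₀ = ∫ x, f₀ x * g x ∂leb01 := by
  have hm : AEMeasurable (fun x => ENNReal.ofReal (f₀ x)) leb01 :=
    (Lp.aestronglyMeasurable f₀).aemeasurable.ennreal_ofReal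
  rw [densityLaw, integral_withDensity_eq_integral_toReal_smul₀ hm
    (Eventually.of_forall fun x => ENNReal.ofReal_lt_top)]
  refine integral_congr_ae ?_
  filter_upwards [hf.1] with x hx
  rw [ENNReal.toReal_ofReal hx, smul_eq_mul]

theorem IsDensity.integral_densityLaw_L2 (hf : IsDensity f₀) (g : L2) :
    ∫ x, g x ∂densityLaw f₀ = inner ℝ f₀ g := by
  rw [hf.integral_densityLaw, L2.inner_def]
  simp [mul_comm]

theorem densityLaw_absolutelyContinuous : densityLaw f₀ ≪ leb01 :=
  withDensity_absolutelyContinuous _ _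

theorem memLp_densityLaw {D : ℝ} (hD : ∀ᵐ x ∂leb01, f₀ x ≤ D) (g : L2) :
    MemLp g 2 (densityLaw f₀) := by
  have hle : densityLaw f₀ ≤ ENNReal.ofReal D • leb01 := by
    rw [densityLaw, ← withDensity_const]
    refine withDensity_mono ?_
    filter_upwards [hD] with x hx
    exact ENNReal.ofReal_le_ofReal hx
  exact ((Lp.memLp g).smul_measure ENNReal.ofReal_ne_top).mono_measure hle

/-- The covariance under a bounded density is a continuous bilinear form on `L²([0,1])`. -/
theorem IsDensity.exists_covariance_form (hf : IsDensity f₀) {D : ℝ}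
    (hD : ∀ᵐ x ∂leb01, f₀ x ≤ D) :
    ∃ B : L2 →L[ℝ] L2 →L[ℝ] ℝ, ∀ g h : L2, B g h = cov[g, h; densityLaw f₀] := by
  have := hf.isProbabilityMeasure
  have hb : MemLp f₀ ∞ leb01 := by
    refine memLp_top_of_bound (Lp.aestronglyMeasurable f₀) D ?_
    filter_upwards [hD, hf.1] with x hx h0
    rwa [Real.norm_of_nonneg h0]
  -- `M` is multiplication by the bounded function `f₀`; the covariance is `⟨f₀ g, h⟩ - ⟨f₀, g⟩ ⟨f₀,
  -- h⟩`.
  let M : L2 →L[ℝ] L2 := (ContinuousLinearMap.mul ℝ ℝ).holderL leb01 ∞ 2 2 hb.toLp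
  let A : L2 →L[ℝ] L2 →L[ℝ] ℝ := innerSL ℝ
  refine ⟨A.comp M - (innerSL ℝ f₀).smulRight (innerSL ℝ f₀), fun g h => ?_⟩
  have hM : (M g : ℝ → ℝ) =ᵐ[leb01] fun x => f₀ x * g x := by
    have := (ContinuousLinearMap.mul ℝ ℝ).coeFn_holder (r := 2) hb.toLp g
    filter_upwards [this, hb.coeFn_toLp] with x h1 h2
    rw [← h2]
    exact h1
  rw [covariance_eq_sub (memLp_densityLaw hD g) (memLp_densityLaw hD h),
    hf.integral_densityLaw_L2, hf.integral_densityLaw_L2, hf.integral_densityLaw]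
  change inner ℝ (M g) h - inner ℝ f₀ g * inner ℝ f₀ h = _
  congr 1
  rw [L2.inner_def]
  refine integral_congr_ae ?_
  filter_upwards [hM] with x hx
  simp only [hx, Pi.mul_apply]
  simp
  ring

theorem covariance_congr_ae {Ω : Type*} [MeasurableSpace Ω] {μ : Measure Ω} {X X' Y Y' : Ω → ℝ}
    (hX : X =ᵐ[μ] X') (hY : Y =ᵐ[μ] Y') : cov[X, Y; μ] = cov[X', Y'; μ] := by
  unfold covariance
  rw [integral_congr_ae hX, integral_congr_ae hY]
  refine integral_congr_ae ?_
  filter_upwards [hX, hY] with x h1 h2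
  rw [h1, h2]

theorem IsDensity.covariance_ind (hf : IsDensity f₀) {D : ℝ} (hD : ∀ᵐ x ∂leb01, f₀ x ≤ D)
    (s t : unitInterval) :
    cov[ind s, ind t; densityLaw f₀] =
      primitive f₀ (min s t) - primitive f₀ s * primitive f₀ t := by
  have := hf.isProbabilityMeasure
  have hi : ∀ r : unitInterval, (ind r : ℝ → ℝ) =ᵐ[densityLaw f₀]
      (Icc (0 : ℝ) r).indicator fun _ => 1 := fun r =>
    densityLaw_absolutelyContinuous.ae_le indicatorConstLp_coeFn
  have hprod : (ind s * ind t : ℝ → ℝ) =ᵐ[densityLaw f₀] ind (min s t) := by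
    filter_upwards [hi s, hi t, hi (min s t)] with x h1 h2 h3
    rw [Pi.mul_apply, h1, h2, h3, ← inter_indicator_mul, Icc_inter_Icc, sup_idem]
    have hmin : ((min s t : unitInterval) : ℝ) = min (s : ℝ) t :=
      Subtype.mono_coe (fun x => x ∈ unitInterval) |>.map_min
    rw [hmin]
    simp only [mul_one]
  rw [covariance_eq_sub (memLp_densityLaw hD _) (memLp_densityLaw hD _), integral_congr_ae hprod]
  simp_rw [hf.integral_densityLaw_L2, primitive_apply_eq_inner, real_inner_comm]

theorem bridgeCov_eq (u : WaveletBasis S J₀) (i j : Idx J₀) :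
    bridgeCov u f₀ i j = cov[u.toL2 i, u.toL2 j; densityLaw f₀] :=
  covariance_congr_ae
    (densityLaw_absolutelyContinuous.ae_le (u.onb.memLp i).coeFn_toLp.symm)
    (densityLaw_absolutelyContinuous.ae_le (u.onb.memLp j).coeFn_toLp.symm)

end Bridge

end MultiscaleBvM

/-! ### The theorem in the two models -/

theorem theorem4 {S J₀ : ℕ} (u : WaveletBasis S J₀) (w : Weights)
    (hw : Summable fun j : ℕ => w j * (2 : ℝ) ^ (-(lev J₀ j) / 2))
    {Ω : Type*} [MeasurableSpace Ω] (P : Measure Ω) [IsProbabilityMeasure P]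
    (f₀ : L2) (Prior : ℕ → Measure L2) (hPrior : ∀ n, IsProbabilityMeasure (Prior n))
    (γ : Measure C01) [IsProbabilityMeasure γ] :
    -- white noise model
    (∀ (W : L2 → Ω → ℝ) (κ : (n : ℕ) → Kernel (Idx J₀ → ℝ) L2),
      IsWhiteNoise W P →
      (∀ n, IsMarkovKernel (κ n)) →
      (∀ n, 1 ≤ n → IsPosterior (whiteNoiseLaw u n) (Prior n) (κ n)) →
      IsBrownianMotionLaw γ →
      -- centring equal to the observation
      (∀ Y : ℕ → Ω → C01, IsTrajectory f₀ W P Y →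
        WeakBvM u w P (fun n ω => κ n (whiteNoiseObs u f₀ W n ω))
          (fun n ω => M0.ofSeq w (whiteNoiseObs u f₀ W n ω)) (whiteCov u) →
        FunctionalLimit P (fun n ω => κ n (whiteNoiseObs u f₀ W n ω)) Y γ ∧
        KolmogorovSmirnovLimit P (fun n ω => κ n (whiteNoiseObs u f₀ W n ω)) Y γ) ∧
      -- centring in `L²`
      (∀ T : (n : ℕ) → (Idx J₀ → ℝ) → L2, (∀ n, Measurable (T n)) →
        WeakBvM u w P (fun n ω => κ n (whiteNoiseObs u f₀ W n ω))
          (fun n ω => u.toM0 w (T n (whiteNoiseObs u f₀ W n ω))) (whiteCov u) →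
        FunctionalLimit P (fun n ω => κ n (whiteNoiseObs u f₀ W n ω))
          (fun n ω => primitive (T n (whiteNoiseObs u f₀ W n ω))) γ ∧
        KolmogorovSmirnovLimit P (fun n ω => κ n (whiteNoiseObs u f₀ W n ω))
          (fun n ω => primitive (T n (whiteNoiseObs u f₀ W n ω))) γ)) ∧
    -- sampling model
    (∀ (X : ℕ → Ω → ℝ) (κ : (n : ℕ) → Kernel (Fin n → ℝ) L2)
        (T : (n : ℕ) → (Fin n → ℝ) → L2),
      IsDensity f₀ → (∃ D : ℝ, ∀ᵐ x ∂leb01, f₀ x ≤ D) →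
      iIndepFun X P → (∀ i, HasLaw (X i) (densityLaw f₀) P) →
      (∀ n, ∀ᵐ f ∂(Prior n), IsDensity f) →
      (∀ n, IsMarkovKernel (κ n)) →
      (∀ n, 1 ≤ n → IsPosterior (samplingLaw n) (Prior n) (κ n)) →
      IsBrownianBridgeLaw f₀ γ →
      (∀ n, Measurable (T n)) →
      WeakBvM u w P (fun n ω => κ n (fun i => X i ω))
        (fun n ω => u.toM0 w (T n (fun i => X i ω))) (bridgeCov u f₀) →
      FunctionalLimit P (fun n ω => κ n (fun i => X i ω))
        (fun n ω => primitive (T n (fun i => X i ω))) γ ∧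
      KolmogorovSmirnovLimit P (fun n ω => κ n (fun i => X i ω))
        (fun n ω => primitive (T n (fun i => X i ω))) γ) := by
  refine ⟨fun W κ hW hκ _ hγ => ⟨fun Y hY hBvM => ?_, fun T _ hBvM => ?_⟩,
    fun X κ T hf₀ hD _ _ _ hκ _ hγ _ hBvM => ?_⟩
  -- The existence of `𝒩` on `M0 J₀ w` forces the coefficients of the white noise into that space
  -- almost surely, so the default value `0` of `M0.ofSeq` occurs only on a null set.
  · obtain ⟨𝒩, -, h𝒩, -⟩ := hBvM.2
    have hpost : ∀ n ω, IsProbabilityMeasure (κ n (whiteNoiseObs u f₀ W n ω)) := fun n ω =>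
      inferInstance
    have hlim := hBvM.functionalLimit hw hpost (innerSL ℝ) (fun _ _ => rfl)
      (fun s t => (inner_ind_ind s t).symm) hγ
      (hY.ae_seriesPrimitive_eq hw hW (ae_mem_m0 (hW.comp_right u.toL2) h𝒩))
    exact ⟨hlim, kolmogorovSmirnovLimit_of_functionalLimit hpost hlim⟩
  · have hpost : ∀ n ω, IsProbabilityMeasure (κ n (whiteNoiseObs u f₀ W n ω)) := fun n ω =>
      inferInstance
    have hlim := hBvM.functionalLimit hw hpost (innerSL ℝ) (fun _ _ => rfl)
      (fun s t => (inner_ind_ind s t).symm) hγ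
      (fun n => Eventually.of_forall fun ω => u.seriesPrimitive_toM0 hw _)
    exact ⟨hlim, kolmogorovSmirnovLimit_of_functionalLimit hpost hlim⟩
  · obtain ⟨D, hD⟩ := hD
    -- The covariance under `P₀` takes the place of the inner product; boundedness of `f₀` makes it
    -- continuous on `L2`.
    obtain ⟨B, hB⟩ := hf₀.exists_covariance_form hD
    have hpost : ∀ n ω, IsProbabilityMeasure (κ n fun i : Fin n => X i ω) := fun n ω =>
      inferInstance
    have hlim := hBvM.functionalLimit hw hpost B
      (fun i j => (bridgeCov_eq u i j).trans (hB _ _).symm)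
      (fun s t => ((hB _ _).trans (hf₀.covariance_ind hD s t)).symm) hγ
      (fun n => Eventually.of_forall fun ω => u.seriesPrimitive_toM0 hw _)
    exact ⟨hlim, kolmogorovSmirnovLimit_of_functionalLimit hpost hlim⟩
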